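/- **Setting.** Let $\Omega\subset\mathbb{R}^2$ be open and let $\mathcal{K}$ be a finite conforming mesh of $\Omega$ consisting of open parallelograms $K=F_K(\widehat K)\subset\Omega$, where $\widehat K=(-1,1)^2$, $F_K(\widehat x)=\mathbf{B}_K\widehat x+\mathbf{a}_K$ and $J_K=\det\mathbf{B}_K\neq0$; conforming means that the closures of the elements cover $\overline\Omega$ and that the closures of two different elements are disjoint or meet in exactly one common vertex or one common closed edge. Let $\mathcal{E}$ be the set of edges, $\mathcal{N}_0$ the set of vertices lying in $\Omega$, $\mathcal{E}_K,\mathcal{N}_K$ the sets of edges and vertices of $K$, and $\mathcal{K}(n)$ the set of elements having $n$ as a vertex. Along $\partial K$ let $\mathbf{n}$ be the exterior unit normal and $\mathbf{t}$ the unit tangent in counterclockwise orientation. For a smooth symmetric tensor $\mathbf{M}$ and $e\in\mathcal{E}_K$ put $$\mathrm{tr}^M_{K,e}(\mathbf{M})=(\mathbf{n}\cdot\mathbf{M}\mathbf{n})|_e,\qquad \mathrm{tr}^q_{K,e}(\mathbf{M})=\bigl(\mathbf{n}\cdot\mathbf{div}\,\mathbf{M}+\partial_{\mathbf{t}}(\mathbf{t}\cdot\mathbf{M}\mathbf{n})\bigr)|_e$$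 (normal-normal trace and effective shear force; $\mathbf{div}$ is the row-wise divergence), and for $n\in\mathcal{N}_K$ put $$[\mathbf{t}\cdot\mathbf{M}\mathbf{n}]_{\partial K}(n)=(\mathbf{t}\cdot\mathbf{M}\mathbf{n})|_{e}(n)-(\mathbf{t}\cdot\mathbf{M}\mathbf{n})|_{e'}(n),$$ where $e,e'\in\mathcal{E}_K$ are the edges that end, respectively start, at $n$ in counterclockwise orientation. Let $\langle\cdot,\cdot\rangle_e$ be the $L_2(e)$ inner product and $P^1(e)$ the polynomials of degree at most $1$ on $e$. Let $\mathbb{X}^0(\widehat K)$ be the space of tensors $\begin{pmatrix}a&b\\ b&c\end{pmatrix}$ with $a\in\mathcal{P}^{1,1}\oplus\langle x^2,x^3\rangle$, $b\in\mathcal{P}^2\oplus\langle x^2y,xy^2\rangle$, $c\in\mathcal{P}^{1,1}\oplus\langle y^2,y^3\rangle$, where $\mathcal{P}^{1,1}$ denotes the polynomials of degree at most $1$ in each variable and $\mathcal{P}^2$ those of total degree at most $2$. Let $\mathbb{X}^0(K)$ be the space of all tensors $\mathbf{M}$ on $K$ with $|J_K|\,\mathbf{M}\circ F_K=\mathbf{B}_K\widehat{\mathbf{M}}\mathbf{B}_K^\top$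 for some $\widehat{\mathbf{M}}\in\mathbb{X}^0(\widehat K)$. Let $\mathbb{X}^{\mathrm{dDiv}}(\mathcal{K})$ be the space of all $\mathbf{M}=(\mathbf{M}_K)_{K}\in\prod_{K\in\mathcal{K}}\mathbb{X}^0(K)$ such that $$\langle\mathrm{tr}^M_{K,e}(\mathbf{M}_K)-\mathrm{tr}^M_{K',e}(\mathbf{M}_{K'}),l\rangle_e=0,\qquad \langle\mathrm{tr}^q_{K,e}(\mathbf{M}_K)+\mathrm{tr}^q_{K',e}(\mathbf{M}_{K'}),l\rangle_e=0\qquad\forall l\in P^1(e)$$ for all $K\neq K'\in\mathcal{K}$ and $e\in\mathcal{E}_K\cap\mathcal{E}_{K'}$, and $$\sum_{K\in\mathcal{K}(n)}[\mathbf{t}\cdot\mathbf{M}_K\mathbf{n}]_{\partial K}(n)=0\qquad\forall n\in\mathcal{N}_0.$$ Let $\mathbb{H}(\mathrm{div}\,\mathbf{div},\Omega)$ be the space of symmetric tensors in $L_2(\Omega)^{2\times2}$ whose distributional $\mathrm{div}\,\mathbf{div}$ is in $L_2(\Omega)$. **Proposition 4.2.** The inclusion $\mathbb{X}^{\mathrm{dDiv}}(\mathcal{K})\subset\mathbb{H}(\mathrm{div}\,\mathbf{div},\Omega)$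 holds (an element of $\mathbb{X}^{\mathrm{dDiv}}(\mathcal{K})$ being identified with the tensor function equal to $\mathbf{M}_K$ on each $K$), and $$\dim\mathbb{X}^{\mathrm{dDiv}}(\mathcal{K})=4\,\#\mathcal{E}+4\,\#\mathcal{K}-\#\mathcal{N}_0.$$ Moreover, choose for every $e\in\mathcal{E}$ an element $K_e$ with $e\in\mathcal{E}_{K_e}$ (an orientation) and a non-constant polynomial $l_e$ of degree $1$ on $e$. Then for all real numbers $m^0_e,m^1_e,q^0_e,q^1_e$ ($e\in\mathcal{E}$) and $g_{K,n}$ ($K\in\mathcal{K}$, $n\in\mathcal{N}_K$) subject to $\sum_{K\in\mathcal{K}(n)}g_{K,n}=0$ for all $n\in\mathcal{N}_0$ there is exactly one $\mathbf{M}\in\mathbb{X}^{\mathrm{dDiv}}(\mathcal{K})$ with $$\langle\mathrm{tr}^M_{K_e,e}(\mathbf{M}_{K_e}),1\rangle_e=m^0_e,\quad\langle\mathrm{tr}^M_{K_e,e}(\mathbf{M}_{K_e}),l_e\rangle_e=m^1_e,\quad\langle\mathrm{tr}^q_{K_e,e}(\mathbf{M}_{K_e}),1\rangle_e=q^0_e,\quad\langle\mathrm{tr}^q_{K_e,e}(\mathbf{M}_{K_e}),l_e\rangle_e=q^1_e\qquad(e\in\mathcal{E})$$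 and $[\mathbf{t}\cdot\mathbf{M}_K\mathbf{n}]_{\partial K}(n)=g_{K,n}$ for all $K\in\mathcal{K}$, $n\in\mathcal{N}_K$. -/

import Mathlib

open Set MeasureTheory
open scoped Matrix ContDiff

noncomputable section

namespace HdDiv

/-- The Euclidean plane. -/
abbrev Plane := EuclideanSpace ℝ (Fin 2)

/-- Real `2 × 2` tensors. -/
abbrev Tensor := Matrix (Fin 2) (Fin 2) ℝ

/-! ### Differential operators and the space `H(div div, Ω)` -/

/-- The partial derivative `∂ᵢ f` of a scalar function. -/
def pd (i : Fin 2) (f : Plane → ℝ) (x : Plane) : ℝ :=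
  fderiv ℝ f x (EuclideanSpace.single i 1)

/-- The row-wise divergence of a tensor function. -/
def rowDiv (M : Plane → Tensor) (x : Plane) : Fin 2 → ℝ :=
  fun i => ∑ j, pd j (fun y => M y i j) x

/-- `M ∈ H(div div, Ω)`: `M` is a symmetric tensor function in `L₂(Ω)` whose distributional
`div div` on `Ω` is (given by) a function `f ∈ L₂(Ω)`. -/
def MemHdDiv (Ω : Set Plane) (M : Plane → Tensor) : Prop :=
  (∀ i j, MemLp (fun x => M x i j) 2 (volume.restrict Ω)) ∧
  (∀ᵐ x ∂(volume.restrict Ω), (M x).IsSymm) ∧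
  ∃ f : Plane → ℝ, MemLp f 2 (volume.restrict Ω) ∧
    ∀ φ : Plane → ℝ, ContDiff ℝ ∞ φ → HasCompactSupport φ → tsupport φ ⊆ Ω →
      ∫ x in Ω, ∑ i, ∑ j, M x i j * pd i (pd j φ) x = ∫ x in Ω, f x * φ x

/-! ### The space `X⁰` on the reference square -/

/-- The monomial `x ^ i * y ^ j` as a function on the plane. -/
def monomial (i j : ℕ) : Plane → ℝ := fun x => x 0 ^ i * x 1 ^ j

/-- Polynomials of total degree at most `r`. -/
def polyTotal (r : ℕ) : Submodule ℝ (Plane → ℝ) :=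
  Submodule.span ℝ {p | ∃ i j : ℕ, i + j ≤ r ∧ p = monomial i j}

/-- Polynomials of degree at most `r` in each of the two variables. -/
def polyBi (r : ℕ) : Submodule ℝ (Plane → ℝ) :=
  Submodule.span ℝ {p | ∃ i j : ℕ, i ≤ r ∧ j ≤ r ∧ p = monomial i j}

/-- The local space on the reference square. A polynomial tensor on a set with interior points
is identified with the polynomial tensor on the whole plane that extends it. -/
def refSpace : Submodule ℝ (Plane → Tensor) where
  carrier := {M | (∀ x, (M x).IsSymm) ∧
    (fun x => M x 0 0) ∈ polyBi 1 ⊔ Submodule.span ℝ {monomial 2 0, monomial 3 0} ∧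
    (fun x => M x 0 1) ∈ polyTotal 2 ⊔ Submodule.span ℝ {monomial 2 1, monomial 1 2} ∧
    (fun x => M x 1 1) ∈ polyBi 1 ⊔ Submodule.span ℝ {monomial 0 2, monomial 0 3}}
  add_mem' := by
    rintro M N ⟨h1, h2, h3, h4⟩ ⟨k1, k2, k3, k4⟩
    exact ⟨fun x => (h1 x).add (k1 x), add_mem h2 k2, add_mem h3 k3, add_mem h4 k4⟩
  zero_mem' := ⟨fun _ => Matrix.isSymm_zero, zero_mem _, zero_mem _, zero_mem _⟩
  smul_mem' := by
    rintro c M ⟨h1, h2, h3, h4⟩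
    exact ⟨fun x => (h1 x).smul c, Submodule.smul_mem _ c h2, Submodule.smul_mem _ c h3,
      Submodule.smul_mem _ c h4⟩

/-! ### Parallelograms -/

/-- The open reference square `(-1,1) × (-1,1)`. -/
def refSquare : Set Plane := {x | ∀ i, |x i| < 1}

/-- The vertices of the reference square, in counterclockwise order. -/
def refVertex : Fin 4 → Plane := ![!₂[-1, -1], !₂[1, -1], !₂[1, 1], !₂[-1, 1]]

/-- A parallelogram, given by an affine map `x ↦ B x + a` (`B` invertible) that maps the
reference square onto it. Both orientations are allowed. -/
structure Parallelogram where
  B : Tensor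
  a : Plane
  det_ne_zero : B.det ≠ 0

namespace Parallelogram

variable (K : Parallelogram)

/-- The affine map `x ↦ B x + a`. -/
def map (x : Plane) : Plane := WithLp.toLp 2 (K.B *ᵥ x.ofLp) + K.a

/-- The inverse of the affine map. -/
def invMap (x : Plane) : Plane := WithLp.toLp 2 (K.B⁻¹ *ᵥ (x - K.a).ofLp)

/-- The open parallelogram. -/
def carrier : Set Plane := K.map '' refSquare

/-- The vertices; consecutive ones (cyclically) are the end points of the edges. -/
def vertex (j : Fin 4) : Plane := K.map (refVertex j)

/-- The `j`-th (relatively open) edge, joining the vertices `j` and `j + 1` (mod `4`). -/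
def edge (j : Fin 4) : Set Plane := openSegment ℝ (K.vertex j) (K.vertex (j + 1))

/-- `1` if the vertices `0,1,2,3` are in counterclockwise order, `-1` if clockwise. -/
def orient : ℝ := if 0 < K.B.det then 1 else -1

/-- Unit tangential vector along the `j`-th edge in the mathematically positive
(counterclockwise) orientation of the boundary. -/
def tangent (j : Fin 4) : Plane :=
  (K.orient / dist (K.vertex j) (K.vertex (j + 1))) • (K.vertex (j + 1) - K.vertex j)

/-- Exterior unit normal vector on the `j`-th edge: the tangential vector turned clockwise by a
right angle. -/
def normal (j : Fin 4) : Plane := !₂[K.tangent j 1, - K.tangent j 0]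

/-- Tangential-normal component `t · M n` with the vectors of the `j`-th edge. -/
def tn (j : Fin 4) (M : Plane → Tensor) (x : Plane) : ℝ :=
  (K.tangent j).ofLp ⬝ᵥ (M x *ᵥ (K.normal j).ofLp)

/-- Normal-normal trace `n · M n` on the `j`-th edge. -/
def trM (j : Fin 4) (M : Plane → Tensor) (x : Plane) : ℝ :=
  (K.normal j).ofLp ⬝ᵥ (M x *ᵥ (K.normal j).ofLp)

/-- Effective shear force `n · div M + ∂ₜ (t · M n)` on the `j`-th edge. -/
def trq (j : Fin 4) (M : Plane → Tensor) (x : Plane) : ℝ :=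
  (K.normal j).ofLp ⬝ᵥ rowDiv M x + fderiv ℝ (K.tn j M) x (K.tangent j)

/-- Jump of `t · M n` at the `j`-th vertex: the value from the edge that ends there minus the
value from the edge that starts there, edges being run through in positive orientation. -/
def jump (j : Fin 4) (M : Plane → Tensor) : ℝ :=
  if 0 < K.B.det then K.tn (j - 1) M (K.vertex j) - K.tn j M (K.vertex j)
  else K.tn j M (K.vertex j) - K.tn (j - 1) M (K.vertex j)

/-- Integral over the `j`-th edge with respect to arc length. -/
def edgeIntegral (j : Fin 4) (f : Plane → ℝ) : ℝ :=
  dist (K.vertex j) (K.vertex (j + 1)) *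
    ∫ s in (0 : ℝ)..1, f (AffineMap.lineMap (K.vertex j) (K.vertex (j + 1)) s)

/-- The Piola--Kirchhoff transformation `|J| M ∘ F = B M̂ Bᵀ`. -/
def piola : (Plane → Tensor) →ₗ[ℝ] (Plane → Tensor) where
  toFun M := fun x => |K.B.det|⁻¹ • (K.B * M (K.invMap x) * K.Bᵀ)
  map_add' M N := by
    funext x
    simp [Matrix.mul_add, Matrix.add_mul]
  map_smul' c M := by
    funext x
    simp [smul_comm c]

/-- The local space `X⁰(K)`, the image of the reference space. -/
def localSpace : Submodule ℝ (Plane → Tensor) := refSpace.map K.piola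

end Parallelogram

/-! ### Smoothness of the local spaces -/

/-- Tensor functions with smooth components. -/
def SmoothTensor (M : Plane → Tensor) : Prop := ∀ i j, ContDiff ℝ ∞ (fun x => M x i j)

theorem contDiff_monomial (i j : ℕ) : ContDiff ℝ ∞ (monomial i j) := by
  unfold monomial
  fun_prop

theorem contDiff_of_mem_span {S : Set (Plane → ℝ)} (hS : ∀ p ∈ S, ContDiff ℝ ∞ p)
    {p : Plane → ℝ} (hp : p ∈ Submodule.span ℝ S) : ContDiff ℝ ∞ p := by
  induction hp using Submodule.span_induction with
  | mem p h => exact hS p h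
  | zero => exact contDiff_const
  | add p q _ _ h k => exact h.add k
  | smul c p _ h => exact contDiff_const.smul h

theorem contDiff_of_mem_sup {S T : Set (Plane → ℝ)} (hS : ∀ p ∈ S, ContDiff ℝ ∞ p)
    (hT : ∀ p ∈ T, ContDiff ℝ ∞ p) {p : Plane → ℝ}
    (hp : p ∈ Submodule.span ℝ S ⊔ Submodule.span ℝ T) : ContDiff ℝ ∞ p := by
  rw [← Submodule.span_union] at hp
  exact contDiff_of_mem_span (fun q hq => hq.elim (hS q) (hT q)) hp

theorem smooth_refSpace {M : Plane → Tensor} (hM : M ∈ refSpace) : SmoothTensor M := by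
  obtain ⟨h1, h2, h3, h4⟩ := hM
  have bi : ∀ r, ∀ p ∈ {p | ∃ i j : ℕ, i ≤ r ∧ j ≤ r ∧ p = monomial i j},
      ContDiff ℝ ∞ p := by
    rintro r p ⟨i, j, -, -, rfl⟩
    exact contDiff_monomial i j
  have tot : ∀ r, ∀ p ∈ {p | ∃ i j : ℕ, i + j ≤ r ∧ p = monomial i j},
      ContDiff ℝ ∞ p := by
    rintro r p ⟨i, j, -, rfl⟩
    exact contDiff_monomial i j
  have pair : ∀ i j k l, ∀ p ∈ ({monomial i j, monomial k l} : Set (Plane → ℝ)),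
      ContDiff ℝ ∞ p := by
    rintro i j k l p (rfl | rfl) <;> exact contDiff_monomial _ _
  have e00 := contDiff_of_mem_sup (bi 1) (pair 2 0 3 0) h2
  have e01 := contDiff_of_mem_sup (tot 2) (pair 2 1 1 2) h3
  have e11 := contDiff_of_mem_sup (bi 1) (pair 0 2 0 3) h4
  have e10 : (fun x => M x 1 0) = fun x => M x 0 1 := funext fun x => (h1 x).apply 0 1
  intro i j
  fin_cases i <;> fin_cases j
  · exact e00
  · exact e01
  · exact e10 ▸ e01
  · exact e11

namespace Parallelogram

variable (K : Parallelogram)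

theorem contDiff_invMap : ContDiff ℝ ∞ K.invMap := by
  unfold invMap
  rw [contDiff_piLp]
  intro i
  simp only [Matrix.mulVec, dotProduct]
  fun_prop

theorem smooth_localSpace {M : Plane → Tensor} (hM : M ∈ K.localSpace) : SmoothTensor M := by
  obtain ⟨N, hN, rfl⟩ := hM
  intro i j
  have h : ∀ k l, ContDiff ℝ ∞ (fun x => N (K.invMap x) k l) :=
    fun k l => (smooth_refSpace hN k l).comp K.contDiff_invMap
  simp only [piola, LinearMap.coe_mk, AddHom.coe_mk, Matrix.smul_apply, Matrix.mul_apply,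
    smul_eq_mul]
  refine contDiff_const.mul (ContDiff.sum fun l _ => ContDiff.mul (ContDiff.sum fun k _ => ?_)
    contDiff_const)
  exact contDiff_const.mul (h k l)

variable {K} {M N : Plane → Tensor}

theorem contDiff_tn (j : Fin 4) (hM : SmoothTensor M) : ContDiff ℝ ∞ (K.tn j M) := by
  have h := fun i j => hM i j
  unfold tn
  simp only [Matrix.mulVec, dotProduct]
  fun_prop

theorem continuous_trM (j : Fin 4) (hM : SmoothTensor M) : Continuous (K.trM j M) := by
  have h := fun i j => (hM i j).continuous
  unfold trM
  simp only [Matrix.mulVec, dotProduct]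
  fun_prop

theorem continuous_trq (j : Fin 4) (hM : SmoothTensor M) : Continuous (K.trq j M) := by
  have h1 := ((K.contDiff_tn j hM).continuous_fderiv (by simp)).clm_apply
    (continuous_const (y := K.tangent j))
  have h2 : ∀ i k l, Continuous (pd i (fun x => M x k l)) := fun i k l =>
    ((hM k l).continuous_fderiv (by simp)).clm_apply continuous_const
  unfold trq
  refine Continuous.add ?_ h1
  simp only [rowDiv, dotProduct]
  fun_prop

theorem tn_add (j : Fin 4) : K.tn j (M + N) = K.tn j M + K.tn j N := by
  funext x
  simp only [tn, Pi.add_apply, Matrix.add_mulVec, dotProduct_add]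

theorem tn_smul (j : Fin 4) (c : ℝ) : K.tn j (c • M) = c • K.tn j M := by
  funext x
  simp only [tn, Pi.smul_apply, Matrix.smul_mulVec, dotProduct_smul]

theorem trM_add (j : Fin 4) : K.trM j (M + N) = K.trM j M + K.trM j N := by
  funext x
  simp only [trM, Pi.add_apply, Matrix.add_mulVec, dotProduct_add]

theorem trM_smul (j : Fin 4) (c : ℝ) : K.trM j (c • M) = c • K.trM j M := by
  funext x
  simp only [trM, Pi.smul_apply, Matrix.smul_mulVec, dotProduct_smul]

theorem trq_add (j : Fin 4) (hM : SmoothTensor M) (hN : SmoothTensor N) :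
    K.trq j (M + N) = K.trq j M + K.trq j N := by
  funext x
  have d : ∀ {f : Plane → ℝ}, ContDiff ℝ ∞ f → DifferentiableAt ℝ f x :=
    fun h => (h.differentiable (by simp)) x
  have h1 : fderiv ℝ (K.tn j (M + N)) x = fderiv ℝ (K.tn j M) x + fderiv ℝ (K.tn j N) x := by
    rw [tn_add]
    exact fderiv_add (d (contDiff_tn j hM)) (d (contDiff_tn j hN))
  have h2 : rowDiv (M + N) x = rowDiv M x + rowDiv N x := by
    funext i
    simp only [rowDiv, Pi.add_apply, ← Finset.sum_add_distrib]
    refine Finset.sum_congr rfl fun k _ => ?_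
    have := fderiv_add (d (hM i k)) (d (hN i k))
    simp only [pd]
    rw [← add_apply, ← this]
    rfl
  simp only [trq, h1, h2, Pi.add_apply, dotProduct_add, add_apply]
  ring

theorem trq_smul (j : Fin 4) (c : ℝ) (hM : SmoothTensor M) :
    K.trq j (c • M) = c • K.trq j M := by
  funext x
  have d : ∀ {f : Plane → ℝ}, ContDiff ℝ ∞ f → DifferentiableAt ℝ f x :=
    fun h => (h.differentiable (by simp)) x
  have h1 : fderiv ℝ (K.tn j (c • M)) x = c • fderiv ℝ (K.tn j M) x := by
    rw [tn_smul]
    exact fderiv_const_smul (d (contDiff_tn j hM)) c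
  have h2 : rowDiv (c • M) x = c • rowDiv M x := by
    funext i
    simp only [rowDiv, Pi.smul_apply, smul_eq_mul, Finset.mul_sum]
    refine Finset.sum_congr rfl fun k _ => ?_
    have := fderiv_const_smul (d (hM i k)) c
    simp only [pd]
    rw [← smul_eq_mul, ← smul_apply, ← this]
    rfl
  simp only [trq, h1, h2, Pi.smul_apply, dotProduct_smul, smul_apply, smul_eq_mul]
  ring

theorem jump_add (j : Fin 4) : K.jump j (M + N) = K.jump j M + K.jump j N := by
  simp only [jump, tn_add, Pi.add_apply]
  split_ifs <;> ring

theorem jump_smul (j : Fin 4) (c : ℝ) : K.jump j (c • M) = c * K.jump j M := by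
  simp only [jump, tn_smul, Pi.smul_apply, smul_eq_mul]
  split_ifs <;> ring

theorem trM_zero (j : Fin 4) : K.trM j 0 = 0 := by
  simpa using trM_smul (K := K) (M := 0) j 0

theorem trq_zero (j : Fin 4) : K.trq j 0 = 0 := by
  simpa using trq_smul (K := K) (M := 0) j 0 fun _ _ => contDiff_const

theorem jump_zero (j : Fin 4) : K.jump j 0 = 0 := by
  simpa using jump_smul (K := K) (M := 0) j 0

theorem edgeIntegral_add (j : Fin 4) {f g : Plane → ℝ} (hf : Continuous f) (hg : Continuous g) :
    K.edgeIntegral j (f + g) = K.edgeIntegral j f + K.edgeIntegral j g := by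
  have h : Continuous fun s : ℝ => (AffineMap.lineMap (K.vertex j) (K.vertex (j + 1)) s : Plane) :=
    AffineMap.lineMap_continuous
  have := intervalIntegral.integral_add ((hf.comp h).intervalIntegrable (μ := volume) 0 1)
    ((hg.comp h).intervalIntegrable 0 1)
  simp only [Function.comp_apply] at this
  simp only [edgeIntegral, Pi.add_apply]
  rw [this, mul_add]

theorem edgeIntegral_smul (j : Fin 4) (c : ℝ) (f : Plane → ℝ) :
    K.edgeIntegral j (c • f) = c * K.edgeIntegral j f := by
  simp only [edgeIntegral, Pi.smul_apply, smul_eq_mul, intervalIntegral.integral_const_mul]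
  ring

end Parallelogram

/-! ### Parallelogram meshes -/

/-- A conforming mesh of the open set `Ω` by parallelograms, indexed by `ι`: the elements are
contained in `Ω`, their closures cover the closure of `Ω`, and the closures of two different
elements are disjoint or meet in exactly one common vertex or one common (closed) edge. -/
structure ParallelogramMesh (Ω : Set Plane) (ι : Type*) where
  elem : ι → Parallelogram
  isOpen : IsOpen Ω
  subset : ∀ i, (elem i).carrier ⊆ Ω
  cover : closure Ω = ⋃ i, closure (elem i).carrier
  conforming : ∀ i i', i ≠ i' →
    closure (elem i).carrier ∩ closure (elem i').carrier = ∅ ∨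
    (∃ j j', (elem i).vertex j = (elem i').vertex j' ∧
      closure (elem i).carrier ∩ closure (elem i').carrier = {(elem i).vertex j}) ∨
    (∃ j j', (elem i).edge j = (elem i').edge j' ∧
      closure (elem i).carrier ∩ closure (elem i').carrier = closure ((elem i).edge j))

namespace ParallelogramMesh

variable {Ω : Set Plane} {ι : Type*} (T : ParallelogramMesh Ω ι)

/-- The set of edges of the mesh. -/
def edges : Set (Set Plane) := {e | ∃ i j, e = (T.elem i).edge j}

/-- The set of interior vertices of the mesh. -/
def interiorVertices : Set Plane := {n | n ∈ Ω ∧ ∃ i j, n = (T.elem i).vertex j}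

open Classical in
/-- The sum, over all elements that have `n` as a vertex, of values attached to the vertices of
the elements. -/
def vertexSum [Fintype ι] (g : ι → Fin 4 → ℝ) (n : Plane) : ℝ :=
  ∑ i, ∑ j, if (T.elem i).vertex j = n then g i j else 0

/-- The space of piecewise tensors `(M_i)_i` with `M_i` in the local space of the `i`-th
element such that, on every edge common to two elements, the normal-normal traces coincide and
the effective shear forces (each with respect to the own exterior normal) add up to zero when
tested with polynomials of degree one, and such that the jumps sum up to zero at interior
vertices. -/
def dDivSpace [Fintype ι] : Submodule ℝ (ι → Plane → Tensor) where
  carrier := {M | (∀ i, M i ∈ (T.elem i).localSpace) ∧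
    (∀ i i' j j', i ≠ i' → (T.elem i).edge j = (T.elem i').edge j' →
      ∀ l : Plane →ᵃ[ℝ] ℝ,
        (T.elem i).edgeIntegral j
          (fun x => ((T.elem i).trM j (M i) x - (T.elem i').trM j' (M i') x) * l x) = 0 ∧
        (T.elem i).edgeIntegral j
          (fun x => ((T.elem i).trq j (M i) x + (T.elem i').trq j' (M i') x) * l x) = 0) ∧
    ∀ n ∈ T.interiorVertices, T.vertexSum (fun i j => (T.elem i).jump j (M i)) n = 0}
  add_mem' := by
    rintro M N ⟨h1, h2, h3⟩ ⟨k1, k2, k3⟩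
    have sM := fun i => (T.elem i).smooth_localSpace (h1 i)
    have sN := fun i => (T.elem i).smooth_localSpace (k1 i)
    refine ⟨fun i => add_mem (h1 i) (k1 i), fun i i' j j' hi he l => ?_, fun n hn => ?_⟩
    · have hl : Continuous l := l.continuous_of_finiteDimensional
      have c1 := fun i j => Parallelogram.continuous_trM (K := T.elem i) j (sM i)
      have c2 := fun i j => Parallelogram.continuous_trM (K := T.elem i) j (sN i)
      have c3 := fun i j => Parallelogram.continuous_trq (K := T.elem i) j (sM i)
      have c4 := fun i j => Parallelogram.continuous_trq (K := T.elem i) j (sN i)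
      obtain ⟨a1, a2⟩ := h2 i i' j j' hi he l
      obtain ⟨b1, b2⟩ := k2 i i' j j' hi he l
      constructor
      · have := Parallelogram.edgeIntegral_add (K := T.elem i) j
          (((c1 i j).sub (c1 i' j')).mul hl) (((c2 i j).sub (c2 i' j')).mul hl)
        refine Eq.trans ?_ (this.trans ((congrArg₂ (· + ·) a1 b1).trans (add_zero 0)))
        congr 1
        funext x
        simp only [Pi.add_apply, Pi.mul_apply, Pi.sub_apply, Parallelogram.trM_add]
        ring
      · have := Parallelogram.edgeIntegral_add (K := T.elem i) j
          (((c3 i j).add (c3 i' j')).mul hl) (((c4 i j).add (c4 i' j')).mul hl)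
        refine Eq.trans ?_ (this.trans ((congrArg₂ (· + ·) a2 b2).trans (add_zero 0)))
        congr 1
        funext x
        simp only [Pi.add_apply, Pi.mul_apply, Parallelogram.trq_add _ (sM _) (sN _)]
        ring
    · have := congrArg₂ (· + ·) (h3 n hn) (k3 n hn)
      simp only [vertexSum, ← Finset.sum_add_distrib, add_zero] at this
      rw [← this]
      refine Finset.sum_congr rfl fun i _ => Finset.sum_congr rfl fun j _ => ?_
      simp only [Pi.add_apply, Parallelogram.jump_add]
      split_ifs <;> simp
  zero_mem' := by
    refine ⟨fun i => zero_mem _, fun i i' j j' hi he l => ?_, fun n hn => ?_⟩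
    · simp only [Pi.zero_apply, Parallelogram.trM_zero, Parallelogram.trq_zero, add_zero,
        sub_zero, zero_mul, Parallelogram.edgeIntegral, intervalIntegral.integral_zero, mul_zero,
        and_self]
    · simp only [vertexSum, Pi.zero_apply, Parallelogram.jump_zero, ite_self,
        Finset.sum_const_zero]
  smul_mem' := by
    rintro c M ⟨h1, h2, h3⟩
    have sM := fun i => (T.elem i).smooth_localSpace (h1 i)
    refine ⟨fun i => Submodule.smul_mem _ c (h1 i), fun i i' j j' hi he l => ?_, fun n hn => ?_⟩
    · obtain ⟨a1, a2⟩ := h2 i i' j j' hi he l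
      constructor
      · have := Parallelogram.edgeIntegral_smul (K := T.elem i) j c
          (fun x => ((T.elem i).trM j (M i) x - (T.elem i').trM j' (M i') x) * l x)
        rw [a1, mul_zero] at this
        rw [← this]
        congr 1
        funext x
        simp only [Pi.smul_apply, Parallelogram.trM_smul, smul_eq_mul]
        ring
      · have := Parallelogram.edgeIntegral_smul (K := T.elem i) j c
          (fun x => ((T.elem i).trq j (M i) x + (T.elem i').trq j' (M i') x) * l x)
        rw [a2, mul_zero] at this
        rw [← this]
        congr 1
        funext x
        simp only [Pi.smul_apply, Parallelogram.trq_smul _ _ (sM _), smul_eq_mul]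
        ring
    · have := congrArg (c * ·) (h3 n hn)
      simp only [vertexSum, Finset.mul_sum, mul_zero] at this
      rw [← this]
      refine Finset.sum_congr rfl fun i _ => Finset.sum_congr rfl fun j _ => ?_
      simp only [Pi.smul_apply, Parallelogram.jump_smul]
      split_ifs <;> simp

/-- The tensor function on `Ω` (defined almost everywhere) that coincides with `M_i` on the
`i`-th open element. -/
def assemble [Fintype ι] (M : ι → Plane → Tensor) : Plane → Tensor :=
  fun x => ∑ i, (T.elem i).carrier.indicator (M i) x

end ParallelogramMesh

end HdDiv

end

/-!
On the reference square the space consists of tensors with `20` free coefficients. On an edge the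
normal-normal trace and the effective shear force of such a tensor are polynomials of degree at most
one, and together with the four vertex jumps they determine the tensor: if the diagonal entries
vanish on the edges with the matching normal, then `a = (1 - x²)(α + βx)` and
`c = (1 - y²)(γ + δy)`; vanishing shear forces then make the off-diagonal entry bilinear, and
vanishing jumps make it zero at the four vertices, which kills everything. Under the
Piola--Kirchhoff transformation by an affine map, the traces on an edge become positive multiples of
the reference traces up to terms that contain only the normal-normal trace and its tangential
derivative (the factor `Parallelogram.skew`), so that unisolvence carries over to every
parallelogram: `Parallelogram.dofs_bijective`.

In a conforming mesh two elements with a common edge lie on different sides of it, hence an edge has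
at most two elements (`ParallelogramMesh.eq_of_common_edge`) and an edge that meets `Ω` has exactly
two (`ParallelogramMesh.exists_common_edge`). The moment conditions across an edge are therefore
equivalent to prescribing on the second side the moments of the first one, up to the sign for the
shear forces. The local unisolvence then gives the global one
(`ParallelogramMesh.existsUnique_dofs`), and the dimension is the number of the edge moments plus
the dimension of the space of vertex values with vanishing sums at interior vertices.

For the inclusion in `H(div div, Ω)`, the divergence theorem for the vector field
`M ∇φ - φ div M` on each element, followed by an integration by parts along the edges, gives
`Parallelogram.green`. The edge terms cancel in pairs, since the moment conditions force pointwise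
equality for polynomials of degree one, or vanish because an edge of a single element does not meet
the support of `φ`; the vertex terms are `φ n` times the sum of the jumps at `n`.
-/

noncomputable section

namespace HdDiv

/-! ### Elements and edges in affine coordinates -/

/-- The sign of the exterior normal of the `j`-th edge of the reference square. -/
def sideSign : Fin 4 → ℝ := ![-1, 1, 1, -1]

/-- The coordinate direction of the normal of the `j`-th edge of the reference square. -/
def sideIdx : Fin 4 → Fin 2 := ![1, 0, 1, 0]

theorem Plane.ext {x y : Plane} (h0 : x 0 = y 0) (h1 : x 1 = y 1) : x = y := by
  ext i
  fin_cases i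
  · exact h0
  · exact h1

namespace Parallelogram

variable (K : Parallelogram)

theorem map_apply (x : Plane) (i : Fin 2) :
    K.map x i = K.B i 0 * x 0 + K.B i 1 * x 1 + K.a i := by
  have h : (K.B *ᵥ x.ofLp) i = K.B i 0 * x 0 + K.B i 1 * x 1 := by
    rw [Matrix.mulVec, dotProduct, Fin.sum_univ_two]
  rw [map, PiLp.add_apply, ← h]

theorem invMap_map (x : Plane) : K.invMap (K.map x) = x := by
  have h : IsUnit K.B.det := isUnit_iff_ne_zero.mpr K.det_ne_zero
  rw [invMap, map, add_sub_cancel_right, Matrix.mulVec_mulVec, Matrix.nonsing_inv_mul _ h,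
    Matrix.one_mulVec]

theorem map_invMap (x : Plane) : K.map (K.invMap x) = x := by
  have h : IsUnit K.B.det := isUnit_iff_ne_zero.mpr K.det_ne_zero
  rw [invMap, map, Matrix.mulVec_mulVec, Matrix.mul_nonsing_inv _ h, Matrix.one_mulVec,
    WithLp.toLp_ofLp, sub_add_cancel]

theorem map_injective : Function.Injective K.map :=
  Function.LeftInverse.injective K.invMap_map

theorem continuous_map : Continuous K.map := by
  unfold map
  fun_prop

theorem continuous_invMap : Continuous K.invMap := K.contDiff_invMap.continuous

/-- The affine function that equals `1` on the `j`-th edge and `-1` on the opposite edge. The open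
element is the set where all four are less than `1`; using four functions, with `coord (j + 2)` the
negative of `coord j`, treats all edges alike. -/
def coord (j : Fin 4) (x : Plane) : ℝ := sideSign j * K.invMap x (sideIdx j)

theorem continuous_coord (j : Fin 4) : Continuous (K.coord j) := by
  have := K.continuous_invMap
  unfold coord
  fun_prop

theorem coord_map (j : Fin 4) (x : Plane) : K.coord j (K.map x) = sideSign j * x (sideIdx j) := by
  rw [coord, invMap_map]

theorem mem_carrier_iff {x : Plane} : x ∈ K.carrier ↔ ∀ j, K.coord j x < 1 := by
  have : x ∈ K.carrier ↔ K.invMap x ∈ refSquare := by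
    constructor
    · rintro ⟨y, hy, rfl⟩
      rwa [invMap_map]
    · exact fun h => ⟨_, h, K.map_invMap x⟩
  rw [this]
  simp only [refSquare, mem_ofPred_eq, Fin.forall_fin_succ, coord, abs_lt,
    sideSign, sideIdx]
  simp
  constructor
  · rintro ⟨⟨_, _⟩, _, _⟩
    refine ⟨?_, ?_, ?_, ?_⟩ <;> linarith
  · rintro ⟨_, _, _, _⟩
    refine ⟨⟨?_, ?_⟩, ?_, ?_⟩ <;> linarith

theorem isOpen_carrier : IsOpen K.carrier := by
  have : K.carrier = ⋂ j, {x | K.coord j x < 1} := by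
    ext x
    simp [mem_carrier_iff]
  rw [this]
  exact isOpen_iInter_of_finite fun j => isOpen_lt (K.continuous_coord j) continuous_const

theorem mem_closure_carrier_iff {x : Plane} : x ∈ closure K.carrier ↔ ∀ j, K.coord j x ≤ 1 := by
  constructor
  · intro h j
    have hc : IsClosed {x | K.coord j x ≤ 1} := isClosed_le (K.continuous_coord j) continuous_const
    exact closure_minimal (fun y hy => ((K.mem_carrier_iff.mp hy) j).le) hc h
  · intro h
    have ht : Filter.Tendsto (fun s : ℝ => K.map (s • K.invMap x)) (nhdsWithin 1 (Ioo 0 1))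
        (nhds x) := by
      have h1 : Continuous fun s : ℝ => K.map (s • K.invMap x) := by
        have := K.continuous_map
        fun_prop
      have := (h1.tendsto 1).mono_left (nhdsWithin_le_nhds (s := Ioo (0 : ℝ) 1))
      simpa [map_invMap] using this
    have : (nhdsWithin (1 : ℝ) (Ioo 0 1)).NeBot := right_nhdsWithin_Ioo_neBot one_pos
    refine mem_closure_of_tendsto ht ?_
    filter_upwards [self_mem_nhdsWithin] with s hs
    rw [mem_carrier_iff]
    intro j
    have h1 : K.coord j (K.map (s • K.invMap x)) = s * K.coord j x := by
      simp only [coord, invMap_map, PiLp.smul_apply, smul_eq_mul]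
      ring
    rw [h1]
    nlinarith [h j, hs.1, hs.2]

/-- The affine parametrisation of the `j`-th edge over `[0, 1]`. -/
def edgePt (j : Fin 4) (s : ℝ) : Plane := AffineMap.lineMap (K.vertex j) (K.vertex (j + 1)) s

/-- The parametrisation of the `j`-th edge of the reference square. -/
def refEdgePt (j : Fin 4) (s : ℝ) : Plane := AffineMap.lineMap (refVertex j) (refVertex (j + 1)) s

theorem refEdgePt_apply (j : Fin 4) (s : ℝ) (i : Fin 2) :
    refEdgePt j s i = refVertex j i + s * (refVertex (j + 1) i - refVertex j i) := by
  simp [refEdgePt, AffineMap.lineMap_apply]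
  ring

theorem edgePt_eq_map (j : Fin 4) (s : ℝ) : K.edgePt j s = K.map (refEdgePt j s) := by
  have : ∀ i, K.edgePt j s i = K.vertex j i + s * (K.vertex (j + 1) i - K.vertex j i) := by
    intro i
    simp [edgePt, AffineMap.lineMap_apply]
    ring
  ext i
  rw [this, map_apply, vertex, vertex, map_apply, map_apply, refEdgePt_apply, refEdgePt_apply]
  ring

theorem edge_eq_image (j : Fin 4) : K.edge j = K.edgePt j '' Ioo 0 1 := by
  rw [edge, openSegment_eq_image_lineMap]
  rfl

theorem coord_edgePt_self (j : Fin 4) (s : ℝ) : K.coord j (K.edgePt j s) = 1 := by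
  rw [edgePt_eq_map, coord_map, refEdgePt_apply]
  fin_cases j <;> simp [sideSign, sideIdx, refVertex]

theorem coord_edgePt_prev (j : Fin 4) (s : ℝ) : K.coord (j - 1) (K.edgePt j s) = 1 - 2 * s := by
  rw [edgePt_eq_map, coord_map, refEdgePt_apply]
  fin_cases j <;> simp [sideSign, sideIdx, refVertex] <;> ring

theorem coord_add_two (j : Fin 4) (x : Plane) : K.coord (j + 2) x = - K.coord j x := by
  fin_cases j <;> simp [coord, sideSign, sideIdx]

theorem coord_edgePt_next (j : Fin 4) (s : ℝ) : K.coord (j + 1) (K.edgePt j s) = 2 * s - 1 := by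
  have h : j + 1 = (j - 1) + 2 := by fin_cases j <;> rfl
  rw [h, coord_add_two, coord_edgePt_prev]
  ring

theorem coord_edgePt_opp (j : Fin 4) (s : ℝ) : K.coord (j + 2) (K.edgePt j s) = -1 := by
  rw [coord_add_two, coord_edgePt_self]

theorem eq_cases (j k : Fin 4) : k = j ∨ k = j - 1 ∨ k = j + 1 ∨ k = j + 2 := by
  revert j k
  decide

theorem coord_lt_of_mem_edge {j k : Fin 4} {x : Plane} (hx : x ∈ K.edge j) (hk : k ≠ j) :
    K.coord k x < 1 := by
  rw [edge_eq_image] at hx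
  obtain ⟨s, hs, rfl⟩ := hx
  rcases eq_cases j k with rfl | rfl | rfl | rfl
  · exact absurd rfl hk
  · rw [coord_edgePt_prev]
    linarith [hs.1]
  · rw [coord_edgePt_next]
    linarith [hs.2]
  · rw [coord_edgePt_opp]
    norm_num

theorem coord_eq_of_mem_edge {j : Fin 4} {x : Plane} (hx : x ∈ K.edge j) : K.coord j x = 1 := by
  rw [edge_eq_image] at hx
  obtain ⟨s, hs, rfl⟩ := hx
  exact K.coord_edgePt_self j s

theorem coord_eq_of_mem_closure_edge {j : Fin 4} {x : Plane} (hx : x ∈ closure (K.edge j)) :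
    K.coord j x = 1 :=
  closure_minimal (fun _ => K.coord_eq_of_mem_edge)
    (isClosed_eq (K.continuous_coord j) continuous_const) hx

theorem edgePt_zero (j : Fin 4) : K.edgePt j 0 = K.vertex j := by simp [edgePt]

theorem edgePt_one (j : Fin 4) : K.edgePt j 1 = K.vertex (j + 1) := by simp [edgePt]

theorem coord_vertex_self (j : Fin 4) : K.coord j (K.vertex j) = 1 := by
  rw [← edgePt_zero, coord_edgePt_self]

theorem coord_vertex_prev (j : Fin 4) : K.coord (j - 1) (K.vertex j) = 1 := by
  rw [← edgePt_zero, coord_edgePt_prev]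
  norm_num

theorem edge_subset_closure (j : Fin 4) : K.edge j ⊆ closure K.carrier := by
  intro x hx
  rw [mem_closure_carrier_iff]
  intro k
  by_cases hk : k = j
  · rw [hk, K.coord_eq_of_mem_edge hx]
  · exact (K.coord_lt_of_mem_edge hx hk).le

theorem edgePt_mem_edge (j : Fin 4) {s : ℝ} (hs : s ∈ Ioo (0 : ℝ) 1) :
    K.edgePt j s ∈ K.edge j := by
  rw [edge_eq_image]
  exact mem_image_of_mem _ hs

theorem edge_injective : Function.Injective K.edge := by
  intro j j' h
  by_contra hne
  have hm : K.edgePt j (1 / 2) ∈ K.edge j := K.edgePt_mem_edge j (by norm_num)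
  have h1 := K.coord_lt_of_mem_edge (h ▸ hm) hne
  linarith [K.coord_eq_of_mem_edge hm]

theorem vertex_ne_next (j : Fin 4) : K.vertex j ≠ K.vertex (j + 1) := by
  intro h
  have h1 := K.coord_edgePt_prev j 0
  have h2 := K.coord_edgePt_prev j 1
  rw [edgePt_zero] at h1
  rw [edgePt_one, ← h, h1] at h2
  norm_num at h2

/-- The length of the `j`-th edge. -/
def len (j : Fin 4) : ℝ := dist (K.vertex j) (K.vertex (j + 1))

theorem len_pos (j : Fin 4) : 0 < K.len j := dist_pos.mpr (K.vertex_ne_next j)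

theorem orient_mul_self : K.orient * K.orient = 1 := by
  unfold orient
  split_ifs <;> norm_num

theorem orient_mul_det : K.orient * K.B.det = |K.B.det| := by
  unfold orient
  split_ifs with h
  · rw [abs_of_pos h, one_mul]
  · rw [abs_of_nonpos (not_lt.mp h)]
    ring

theorem tangent_apply (j : Fin 4) (i : Fin 2) :
    K.tangent j i = K.orient / K.len j *
      (K.B i 0 * (refVertex (j + 1) 0 - refVertex j 0) +
        K.B i 1 * (refVertex (j + 1) 1 - refVertex j 1)) := by
  have : K.tangent j i = K.orient / K.len j * (K.vertex (j + 1) i - K.vertex j i) := by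
    simp [tangent, len]
  rw [this, vertex, vertex, map_apply, map_apply]
  ring

theorem normal_apply_zero (j : Fin 4) : K.normal j 0 = K.tangent j 1 := by simp [normal]

theorem normal_apply_one (j : Fin 4) : K.normal j 1 = - K.tangent j 0 := by simp [normal]

/-- The exterior normal of the `j`-th edge is a positive multiple of the gradient of `coord j`. -/
theorem normal_dot_sub (j : Fin 4) (x y : Plane) :
    K.normal j 0 * (x 0 - y 0) + K.normal j 1 * (x 1 - y 1) =
      2 * |K.B.det| / K.len j * (K.coord j x - K.coord j y) := by
  obtain ⟨x, rfl⟩ : ∃ z, x = K.map z := ⟨_, (K.map_invMap x).symm⟩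
  obtain ⟨y, rfl⟩ : ∃ z, y = K.map z := ⟨_, (K.map_invMap y).symm⟩
  rw [normal_apply_zero, normal_apply_one, tangent_apply, tangent_apply, coord_map, coord_map,
    ← orient_mul_det, Matrix.det_fin_two]
  simp only [map_apply]
  fin_cases j <;> simp [sideSign, sideIdx, refVertex] <;> ring

theorem normal_factor_pos (j : Fin 4) : 0 < 2 * |K.B.det| / K.len j := by
  have := abs_pos.mpr K.det_ne_zero
  have := K.len_pos j
  positivity

theorem norm_sq_vertex_sub (j : Fin 4) :
    (K.vertex (j + 1) 0 - K.vertex j 0) ^ 2 + (K.vertex (j + 1) 1 - K.vertex j 1) ^ 2 =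
      K.len j ^ 2 := by
  rw [len, dist_comm, EuclideanSpace.dist_eq, Real.sq_sqrt (by positivity), Fin.sum_univ_two,
    Real.dist_eq, Real.dist_eq, sq_abs, sq_abs]

theorem tangent_sq (j : Fin 4) : K.tangent j 0 ^ 2 + K.tangent j 1 ^ 2 = 1 := by
  have h : ∀ i, K.tangent j i = K.orient / K.len j * (K.vertex (j + 1) i - K.vertex j i) := by
    intro i
    simp [tangent, len]
  have h1 := K.norm_sq_vertex_sub j
  have h2 := K.orient_mul_self
  have h3 := (K.len_pos j).ne'
  rw [h, h]
  field_simp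
  rw [h1]
  linear_combination K.len j ^ 2 * h2

theorem tangent_ne_zero (j : Fin 4) : K.tangent j ≠ 0 := by
  intro h
  have := K.tangent_sq j
  simp [h] at this

theorem edgeIntegral_eq (j : Fin 4) (f : Plane → ℝ) :
    K.edgeIntegral j f = K.len j * ∫ s in (0 : ℝ)..1, f (K.edgePt j s) := rfl

theorem isBounded_carrier : Bornology.IsBounded K.carrier := by
  have hc : IsCompact (closure refSquare) := by
    refine Metric.isCompact_of_isClosed_isBounded isClosed_closure (Bornology.IsBounded.closure ?_)
    refine (Metric.isBounded_iff_subset_closedBall 0).mpr ⟨2, fun x hx => ?_⟩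
    rw [mem_closedBall_zero_iff, EuclideanSpace.norm_eq, Real.sqrt_le_left (by norm_num),
      Fin.sum_univ_two]
    have h0 := hx 0
    have h1 := hx 1
    simp only [Real.norm_eq_abs]
    nlinarith [abs_nonneg (x 0), abs_nonneg (x 1)]
  exact (hc.image K.continuous_map).isBounded.subset (image_mono subset_closure)

end Parallelogram

/-- A nondegenerate segment determines its end points up to order. -/
theorem openSegment_eq_iff_endpoints {a b c d : Plane} (hab : a ≠ b)
    (h : openSegment ℝ a b = openSegment ℝ c d) : (a = c ∧ b = d) ∨ (a = d ∧ b = c) := by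
  have hs : segment ℝ a b = segment ℝ c d := by
    rw [← closure_openSegment, ← closure_openSegment, h]
  have ha : a ∈ segment ℝ c d := hs ▸ left_mem_segment ℝ a b
  have hb : b ∈ segment ℝ c d := hs ▸ right_mem_segment ℝ a b
  have hc : c ∈ segment ℝ a b := hs ▸ left_mem_segment ℝ c d
  have hd : d ∈ segment ℝ a b := hs ▸ right_mem_segment ℝ c d
  rw [segment_eq_image_lineMap] at ha hb hc hd
  obtain ⟨p, hp, rfl⟩ := ha
  obtain ⟨q, hq, rfl⟩ := hb
  obtain ⟨r, hr, hr'⟩ := hc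
  obtain ⟨t, ht, ht'⟩ := hd
  have hcd : c ≠ d := by
    rintro rfl
    simp at hab
  have e1 : AffineMap.lineMap c d (p + r * (q - p)) = (AffineMap.lineMap c d (0 : ℝ) : Plane) := by
    rw [AffineMap.lineMap_apply_zero]
    conv_rhs => rw [← hr']
    simp only [AffineMap.lineMap_apply_module]
    module
  have e2 : AffineMap.lineMap c d (p + t * (q - p)) = (AffineMap.lineMap c d (1 : ℝ) : Plane) := by
    rw [AffineMap.lineMap_apply_one]
    conv_rhs => rw [← ht']
    simp only [AffineMap.lineMap_apply_module]
    module
  have e1 := AffineMap.lineMap_injective ℝ hcd e1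
  have e2 := AffineMap.lineMap_injective ℝ hcd e2
  obtain ⟨hp0, hp1⟩ := hp
  obtain ⟨hq0, hq1⟩ := hq
  obtain ⟨hr0, hr1⟩ := hr
  obtain ⟨ht0, ht1⟩ := ht
  rcases le_total p q with hpq | hpq
  · have hp' : p = 0 := by nlinarith
    have hq' : q = 1 := by nlinarith
    left
    simp [hp', hq']
  · have hp' : p = 1 := by nlinarith
    have hq' : q = 0 := by nlinarith
    right
    simp [hp', hq']

/-! ### Common edges of neighbouring elements -/

namespace Parallelogram

theorem edgePt_reverse (K : Parallelogram) (j : Fin 4) (s : ℝ) :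
    (AffineMap.lineMap (K.vertex (j + 1)) (K.vertex j) s : Plane) = K.edgePt j (1 - s) := by
  rw [edgePt, AffineMap.lineMap_apply_one_sub]

variable {K K' : Parallelogram} {j j' : Fin 4}

theorem vertex_of_edge_eq (h : K.edge j = K'.edge j') :
    (K.vertex j = K'.vertex j' ∧ K.vertex (j + 1) = K'.vertex (j' + 1)) ∨
      (K.vertex j = K'.vertex (j' + 1) ∧ K.vertex (j + 1) = K'.vertex j') :=
  openSegment_eq_iff_endpoints (K.vertex_ne_next j) h

theorem edgePt_of_edge_eq (h : K.edge j = K'.edge j') :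
    (∀ s, K'.edgePt j' s = K.edgePt j s) ∨ ∀ s, K'.edgePt j' s = K.edgePt j (1 - s) := by
  rcases vertex_of_edge_eq h with ⟨h1, h2⟩ | ⟨h1, h2⟩
  · left
    intro s
    rw [edgePt, edgePt, h1, h2]
  · right
    intro s
    rw [← edgePt_reverse, edgePt, h1, h2]

theorem len_of_edge_eq (h : K.edge j = K'.edge j') : K'.len j' = K.len j := by
  rcases vertex_of_edge_eq h with ⟨h1, h2⟩ | ⟨h1, h2⟩
  · rw [len, len, h1, h2]
  · rw [len, len, h1, h2, dist_comm]

/-- The integral over an edge does not depend on the element the edge is seen from. -/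
theorem edgeIntegral_of_edge_eq (h : K.edge j = K'.edge j') (f : Plane → ℝ) :
    K'.edgeIntegral j' f = K.edgeIntegral j f := by
  rw [edgeIntegral_eq, edgeIntegral_eq, len_of_edge_eq h]
  rcases edgePt_of_edge_eq h with h1 | h1
  · simp only [h1]
  · simp only [h1]
    rw [intervalIntegral.integral_comp_sub_left (fun s => f (K.edgePt j s)) 1]
    norm_num

theorem orient_eq_one_or (K : Parallelogram) : K.orient = 1 ∨ K.orient = -1 := by
  unfold orient
  split_ifs <;> simp

theorem tangent_of_edge_eq (h : K.edge j = K'.edge j') :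
    K'.tangent j' = K.tangent j ∨ K'.tangent j' = - K.tangent j := by
  have hl := len_of_edge_eq h
  simp only [len] at hl
  rw [tangent, tangent, hl]
  rcases vertex_of_edge_eq h with ⟨h1, h2⟩ | ⟨h1, h2⟩ <;> rw [← h1, ← h2] <;>
    rcases K.orient_eq_one_or with e | e <;> rcases K'.orient_eq_one_or with e' | e' <;>
    rw [e, e']
  · left; rfl
  · right; module
  · right; module
  · left; rfl
  · right; module
  · left; module
  · left; module
  · right; module

variable (K)

theorem normal_sq (j : Fin 4) : K.normal j 0 ^ 2 + K.normal j 1 ^ 2 = 1 := by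
  rw [normal_apply_zero, normal_apply_one, ← K.tangent_sq j]
  ring

theorem coord_add_smul_normal (j : Fin 4) (x : Plane) (ε : ℝ) :
    K.coord j (x + ε • K.normal j) = K.coord j x + ε / (2 * |K.B.det| / K.len j) := by
  have h := K.normal_dot_sub j (x + ε • K.normal j) x
  have h1 := K.normal_sq j
  have h2 := (K.normal_factor_pos j).ne'
  simp only [PiLp.add_apply, PiLp.smul_apply, smul_eq_mul] at h
  have h3 : 2 * |K.B.det| / K.len j * (K.coord j (x + ε • K.normal j) - K.coord j x) = ε := by
    rw [← h]
    linear_combination ε * h1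
  rw [eq_comm, ← eq_sub_iff_add_eq', div_eq_iff h2]
  linear_combination - h3

/-- Moving from a point of an edge against the exterior normal leads into the element. -/
theorem eventually_mem_carrier {j : Fin 4} {x : Plane} (hx : x ∈ K.edge j) :
    ∀ᶠ ε : ℝ in nhdsWithin 0 (Ioi 0), x + (-ε) • K.normal j ∈ K.carrier := by
  have h : ∀ k, ∀ᶠ ε : ℝ in nhdsWithin 0 (Ioi 0), K.coord k (x + (-ε) • K.normal j) < 1 := by
    intro k
    by_cases hk : k = j
    · subst hk
      filter_upwards [self_mem_nhdsWithin] with ε hε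
      rw [coord_add_smul_normal, K.coord_eq_of_mem_edge hx, neg_div]
      have := div_pos (mem_Ioi.mp hε) (K.normal_factor_pos k)
      linarith
    · have hc : Continuous fun ε : ℝ => K.coord k (x + (-ε) • K.normal j) := by
        have := K.continuous_coord k
        fun_prop
      have h0 : K.coord k (x + (-(0 : ℝ)) • K.normal j) < 1 := by
        simpa using K.coord_lt_of_mem_edge hx hk
      exact nhdsWithin_le_nhds (hc.continuousAt.eventually_lt continuousAt_const h0)
  filter_upwards [Filter.eventually_all.mpr h] with ε hε
  exact K.mem_carrier_iff.mpr hε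

theorem vertex_notMem_edge (j k : Fin 4) : K.vertex k ∉ K.edge j := by
  intro h
  by_cases hk : k = j
  · subst hk
    have h1 := K.coord_lt_of_mem_edge (k := k - 1) h ((by decide : ∀ k : Fin 4, k - 1 ≠ k) k)
    rw [coord_vertex_prev] at h1
    exact h1.false
  · have h1 := K.coord_lt_of_mem_edge h hk
    rw [coord_vertex_self] at h1
    exact h1.false

end Parallelogram

namespace ParallelogramMesh

variable {Ω : Set Plane} {ι : Type*} (T : ParallelogramMesh Ω ι)

theorem notMem_closure {i i' : ι} (hi : i ≠ i') {x : Plane} (hx : x ∈ (T.elem i).carrier) :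
    x ∉ closure (T.elem i').carrier := by
  intro hx'
  have hm : x ∈ closure (T.elem i).carrier ∩ closure (T.elem i').carrier := ⟨subset_closure hx, hx'⟩
  rw [Parallelogram.mem_carrier_iff] at hx
  rcases T.conforming i i' hi with h | ⟨j, j', -, h⟩ | ⟨j, j', -, h⟩
  · rw [h] at hm
    exact hm
  · rw [h, mem_singleton_iff] at hm
    have := hx j
    rw [hm, Parallelogram.coord_vertex_self] at this
    exact this.false
  · rw [h] at hm
    have := hx j
    rw [Parallelogram.coord_eq_of_mem_closure_edge _ hm] at this
    exact this.false

theorem normal_eq_of_tangent_eq {K K' : Parallelogram} {j j' : Fin 4}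
    (h : K'.tangent j' = K.tangent j) : K'.normal j' = K.normal j := by
  rw [Parallelogram.normal, Parallelogram.normal, h]

/-- Two elements lie on different sides of a common edge: otherwise both would contain the points
next to it on the same side. -/
theorem tangent_eq_neg {i i' : ι} {j j' : Fin 4} (hi : i ≠ i')
    (h : (T.elem i).edge j = (T.elem i').edge j') :
    (T.elem i').tangent j' = - (T.elem i).tangent j := by
  refine (Parallelogram.tangent_of_edge_eq h).resolve_left fun ht => ?_
  have hx := (T.elem i).edgePt_mem_edge j (s := 1 / 2) (by norm_num)
  have h1 := (T.elem i).eventually_mem_carrier hx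
  have h2 := (T.elem i').eventually_mem_carrier (h ▸ hx)
  obtain ⟨ε, h1, h2⟩ := (h1.and h2).exists
  rw [normal_eq_of_tangent_eq ht] at h2
  exact T.notMem_closure hi h1 (subset_closure h2)

theorem normal_eq_neg {i i' : ι} {j j' : Fin 4} (hi : i ≠ i')
    (h : (T.elem i).edge j = (T.elem i').edge j') :
    (T.elem i').normal j' = - (T.elem i).normal j := by
  have := T.tangent_eq_neg hi h
  refine Plane.ext ?_ ?_
  · rw [PiLp.neg_apply, Parallelogram.normal_apply_zero, Parallelogram.normal_apply_zero, this]
    rfl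
  · rw [PiLp.neg_apply, Parallelogram.normal_apply_one, Parallelogram.normal_apply_one, this]
    rfl

/-- An edge belongs to at most two elements, as the tangential vectors of any two differ in sign. -/
theorem eq_of_common_edge {i i' i'' : ι} {j j' j'' : Fin 4} (hi' : i ≠ i') (hi'' : i ≠ i'')
    (h' : (T.elem i).edge j = (T.elem i').edge j')
    (h'' : (T.elem i).edge j = (T.elem i'').edge j'') : i' = i'' := by
  by_contra hne
  have h1 := T.tangent_eq_neg hi' h'
  have h2 := T.tangent_eq_neg hi'' h''
  have h3 := T.tangent_eq_neg hne (h'.symm.trans h'')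
  rw [h1, h2, neg_neg] at h3
  have h4 : (2 : ℝ) • (T.elem i).tangent j = 0 := by
    rw [two_smul]
    nth_rewrite 1 [← h3]
    exact neg_add_cancel _
  exact (T.elem i).tangent_ne_zero j ((smul_eq_zero.mp h4).resolve_left two_ne_zero)

/-- An edge that meets `Ω` belongs to a second element. -/
theorem exists_common_edge [Finite ι] {i : ι} {j : Fin 4} {x : Plane}
    (hx : x ∈ (T.elem i).edge j) (hΩ : x ∈ Ω) :
    ∃ i' j', i ≠ i' ∧ (T.elem i).edge j = (T.elem i').edge j' := by
  -- The points `x + ε n` approach `x` from outside of the `i`-th element; one of the finitely many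
  -- other closed elements contains them for arbitrarily small `ε`, and so contains `x`.
  have hlim : Filter.Tendsto (fun ε : ℝ => x + ε • (T.elem i).normal j) (nhdsWithin 0 (Ioi 0))
      (nhds x) := by
    have h1 : Continuous fun ε : ℝ => x + ε • (T.elem i).normal j := by fun_prop
    simpa using (h1.tendsto 0).mono_left (nhdsWithin_le_nhds (s := Ioi (0 : ℝ)))
  have hev : ∀ᶠ ε : ℝ in nhdsWithin 0 (Ioi 0), ∃ i', i ≠ i' ∧
      x + ε • (T.elem i).normal j ∈ closure (T.elem i').carrier := by
    filter_upwards [hlim.eventually (T.isOpen.mem_nhds hΩ), self_mem_nhdsWithin] with ε h1 h2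
    have h3 := T.cover ▸ subset_closure h1
    obtain ⟨i', hi'⟩ := mem_iUnion.mp h3
    refine ⟨i', ?_, hi'⟩
    rintro rfl
    have h4 := (T.elem i).mem_closure_carrier_iff.mp hi' j
    rw [Parallelogram.coord_add_smul_normal, Parallelogram.coord_eq_of_mem_edge _ hx] at h4
    have := div_pos (mem_Ioi.mp h2) ((T.elem i).normal_factor_pos j)
    linarith
  obtain ⟨i', hi'⟩ : ∃ i', ∃ᶠ ε : ℝ in nhdsWithin 0 (Ioi 0), i ≠ i' ∧
      x + ε • (T.elem i).normal j ∈ closure (T.elem i').carrier := by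
    by_contra hcon
    simp only [not_exists, Filter.not_frequently] at hcon
    obtain ⟨ε, ⟨i', h1⟩, h2⟩ := (hev.and (Filter.eventually_all.mpr hcon)).exists
    exact h2 i' h1
  have hne : i ≠ i' := hi'.exists.choose_spec.1
  have hx' : x ∈ closure (T.elem i').carrier :=
    isClosed_closure.mem_of_frequently_of_tendsto (hi'.mono fun _ h => h.2) hlim
  have hm : x ∈ closure (T.elem i).carrier ∩ closure (T.elem i').carrier :=
    ⟨(T.elem i).edge_subset_closure j hx, hx'⟩
  rcases T.conforming i i' hne with h | ⟨k, k', -, h⟩ | ⟨k, k', hk, h⟩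
  · rw [h] at hm
    exact hm.elim
  · rw [h, mem_singleton_iff] at hm
    exact absurd (hm ▸ hx) ((T.elem i).vertex_notMem_edge j k)
  · rw [h] at hm
    have h1 := (T.elem i).coord_eq_of_mem_closure_edge hm
    have : k = j := by
      by_contra hkj
      exact ((T.elem i).coord_lt_of_mem_edge hx hkj).ne h1
    exact ⟨i', k', hne, this ▸ hk⟩

end ParallelogramMesh

/-! ### Partial derivatives -/

theorem Plane.eq_smul_add (v : Plane) :
    v = v 0 • EuclideanSpace.single 0 (1 : ℝ) + v 1 • EuclideanSpace.single 1 (1 : ℝ) := by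
  refine Plane.ext ?_ ?_ <;> simp

theorem fderiv_apply_eq_pd (f : Plane → ℝ) (x v : Plane) :
    fderiv ℝ f x v = v 0 * pd 0 f x + v 1 * pd 1 f x := by
  conv_lhs => rw [Plane.eq_smul_add v]
  rw [map_add, map_smul, map_smul]
  rfl

theorem pd_add {i : Fin 2} {f g : Plane → ℝ} {x : Plane} (hf : DifferentiableAt ℝ f x)
    (hg : DifferentiableAt ℝ g x) :
    pd i (fun y => f y + g y) x = pd i f x + pd i g x := by
  rw [pd, fderiv_fun_add hf hg]
  rfl

theorem pd_sub {i : Fin 2} {f g : Plane → ℝ} {x : Plane} (hf : DifferentiableAt ℝ f x)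
    (hg : DifferentiableAt ℝ g x) :
    pd i (fun y => f y - g y) x = pd i f x - pd i g x := by
  rw [pd, fderiv_fun_sub hf hg]
  rfl

theorem pd_mul {i : Fin 2} {f g : Plane → ℝ} {x : Plane} (hf : DifferentiableAt ℝ f x)
    (hg : DifferentiableAt ℝ g x) :
    pd i (fun y => f y * g y) x = f x * pd i g x + g x * pd i f x := by
  rw [pd, fderiv_fun_mul hf hg]
  rfl

theorem pd_const_mul {i : Fin 2} (c : ℝ) {f : Plane → ℝ} {x : Plane}
    (hf : DifferentiableAt ℝ f x) : pd i (fun y => c * f y) x = c * pd i f x := by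
  rw [pd, fderiv_const_mul hf]
  rfl

theorem pd_sum {i : Fin 2} {κ : Type*} (s : Finset κ) {f : κ → Plane → ℝ} {x : Plane}
    (hf : ∀ k ∈ s, DifferentiableAt ℝ (f k) x) :
    pd i (fun y => ∑ k ∈ s, f k y) x = ∑ k ∈ s, pd i (f k) x := by
  rw [pd, fderiv_fun_sum hf]
  simp [pd]

theorem differentiable_monomial (m n : ℕ) : Differentiable ℝ (monomial m n) :=
  (contDiff_monomial m n).differentiable (by simp)

theorem pd_zero_monomial (m n : ℕ) (x : Plane) :
    pd 0 (monomial m n) x = m * x 0 ^ (m - 1) * x 1 ^ n := by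
  have h0 : HasFDerivAt (fun x : Plane => x 0) (EuclideanSpace.proj 0 : Plane →L[ℝ] ℝ) x :=
    (EuclideanSpace.proj 0 : Plane →L[ℝ] ℝ).hasFDerivAt
  have h1 : HasFDerivAt (fun x : Plane => x 1) (EuclideanSpace.proj 1 : Plane →L[ℝ] ℝ) x :=
    (EuclideanSpace.proj 1 : Plane →L[ℝ] ℝ).hasFDerivAt
  have h := (h0.pow m).mul (h1.pow n)
  rw [pd, show monomial m n = (fun x : Plane => x 0 ^ m) * (fun x : Plane => x 1 ^ n) from rfl,
    h.fderiv]
  simp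
  ring

theorem pd_one_monomial (m n : ℕ) (x : Plane) :
    pd 1 (monomial m n) x = n * x 0 ^ m * x 1 ^ (n - 1) := by
  have h0 : HasFDerivAt (fun x : Plane => x 0) (EuclideanSpace.proj 0 : Plane →L[ℝ] ℝ) x :=
    (EuclideanSpace.proj 0 : Plane →L[ℝ] ℝ).hasFDerivAt
  have h1 : HasFDerivAt (fun x : Plane => x 1) (EuclideanSpace.proj 1 : Plane →L[ℝ] ℝ) x :=
    (EuclideanSpace.proj 1 : Plane →L[ℝ] ℝ).hasFDerivAt
  have h := (h0.pow m).mul (h1.pow n)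
  rw [pd, show monomial m n = (fun x : Plane => x 0 ^ m) * (fun x : Plane => x 1 ^ n) from rfl,
    h.fderiv]
  simp
  ring

/-! ### Coefficients of the reference space -/

/-- The monomials in the upper left component of the reference space. -/
def monomsA : Fin 6 → Plane → ℝ :=
  ![monomial 0 0, monomial 1 0, monomial 0 1, monomial 1 1, monomial 2 0, monomial 3 0]

/-- The monomials in the off-diagonal component of the reference space. -/
def monomsB : Fin 8 → Plane → ℝ :=
  ![monomial 0 0, monomial 1 0, monomial 0 1, monomial 2 0, monomial 1 1, monomial 0 2,
    monomial 2 1, monomial 1 2]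

/-- The monomials in the lower right component of the reference space. -/
def monomsC : Fin 6 → Plane → ℝ :=
  ![monomial 0 0, monomial 1 0, monomial 0 1, monomial 1 1, monomial 0 2, monomial 0 3]

theorem span_monomsA :
    polyBi 1 ⊔ Submodule.span ℝ {monomial 2 0, monomial 3 0} =
      Submodule.span ℝ (range monomsA) := by
  rw [polyBi, ← Submodule.span_union]
  congr 1
  ext p
  constructor
  · rintro (⟨i, j, hi, hj, rfl⟩ | rfl | rfl)
    · interval_cases i <;> interval_cases j
      exacts [⟨0, rfl⟩, ⟨2, rfl⟩, ⟨1, rfl⟩, ⟨3, rfl⟩]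
    exacts [⟨4, rfl⟩, ⟨5, rfl⟩]
  · rintro ⟨k, rfl⟩
    fin_cases k
    exacts [.inl ⟨0, 0, by simp, by simp, rfl⟩, .inl ⟨1, 0, by simp, by simp, rfl⟩,
      .inl ⟨0, 1, by simp, by simp, rfl⟩, .inl ⟨1, 1, by simp, by simp, rfl⟩,
      .inr (.inl rfl), .inr (.inr rfl)]

theorem span_monomsC :
    polyBi 1 ⊔ Submodule.span ℝ {monomial 0 2, monomial 0 3} =
      Submodule.span ℝ (range monomsC) := by
  rw [polyBi, ← Submodule.span_union]
  congr 1
  ext p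
  constructor
  · rintro (⟨i, j, hi, hj, rfl⟩ | rfl | rfl)
    · interval_cases i <;> interval_cases j
      exacts [⟨0, rfl⟩, ⟨2, rfl⟩, ⟨1, rfl⟩, ⟨3, rfl⟩]
    exacts [⟨4, rfl⟩, ⟨5, rfl⟩]
  · rintro ⟨k, rfl⟩
    fin_cases k
    exacts [.inl ⟨0, 0, by simp, by simp, rfl⟩, .inl ⟨1, 0, by simp, by simp, rfl⟩,
      .inl ⟨0, 1, by simp, by simp, rfl⟩, .inl ⟨1, 1, by simp, by simp, rfl⟩,
      .inr (.inl rfl), .inr (.inr rfl)]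

theorem span_monomsB :
    polyTotal 2 ⊔ Submodule.span ℝ {monomial 2 1, monomial 1 2} =
      Submodule.span ℝ (range monomsB) := by
  rw [polyTotal, ← Submodule.span_union]
  congr 1
  ext p
  constructor
  · rintro (⟨i, j, hij, rfl⟩ | rfl | rfl)
    · obtain ⟨rfl, rfl⟩ | ⟨rfl, rfl⟩ | ⟨rfl, rfl⟩ | ⟨rfl, rfl⟩ | ⟨rfl, rfl⟩ | ⟨rfl, rfl⟩ :
          (i = 0 ∧ j = 0) ∨ (i = 1 ∧ j = 0) ∨ (i = 0 ∧ j = 1) ∨ (i = 2 ∧ j = 0) ∨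
            (i = 1 ∧ j = 1) ∨ (i = 0 ∧ j = 2) := by omega
      exacts [⟨0, rfl⟩, ⟨1, rfl⟩, ⟨2, rfl⟩, ⟨3, rfl⟩, ⟨4, rfl⟩, ⟨5, rfl⟩]
    exacts [⟨6, rfl⟩, ⟨7, rfl⟩]
  · rintro ⟨k, rfl⟩
    fin_cases k
    exacts [.inl ⟨0, 0, by simp, rfl⟩, .inl ⟨1, 0, by simp, rfl⟩,
      .inl ⟨0, 1, by simp, rfl⟩, .inl ⟨2, 0, by simp, rfl⟩, .inl ⟨1, 1, by simp, rfl⟩,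
      .inl ⟨0, 2, by simp, rfl⟩, .inr (.inl rfl), .inr (.inr rfl)]

/-- The coefficients of a tensor of the reference space with respect to the monomials. -/
abbrev Coeffs := (Fin 6 → ℝ) × (Fin 8 → ℝ) × (Fin 6 → ℝ)

/-- The tensor of the reference space with given coefficients. -/
def refTensor : Coeffs →ₗ[ℝ] Plane → Tensor where
  toFun θ x := !![∑ k, θ.1 k * monomsA k x, ∑ k, θ.2.1 k * monomsB k x;
    ∑ k, θ.2.1 k * monomsB k x, ∑ k, θ.2.2 k * monomsC k x]
  map_add' θ η := by
    funext x
    ext i j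
    fin_cases i <;> fin_cases j <;> simp [add_mul, Finset.sum_add_distrib]
  map_smul' c θ := by
    funext x
    ext i j
    fin_cases i <;> fin_cases j <;> simp [Finset.mul_sum, mul_assoc]

theorem refTensor_mem (θ : Coeffs) : refTensor θ ∈ refSpace := by
  refine ⟨fun x => ?_, ?_, ?_, ?_⟩
  · ext i j
    fin_cases i <;> fin_cases j <;> rfl
  · rw [span_monomsA, Submodule.mem_span_range_iff_exists_fun]
    exact ⟨θ.1, by ext x; simp [refTensor]⟩
  · rw [span_monomsB, Submodule.mem_span_range_iff_exists_fun]
    exact ⟨θ.2.1, by ext x; simp [refTensor]⟩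
  · rw [span_monomsC, Submodule.mem_span_range_iff_exists_fun]
    exact ⟨θ.2.2, by ext x; simp [refTensor]⟩

theorem exists_refTensor {N : Plane → Tensor} (hN : N ∈ refSpace) : ∃ θ, refTensor θ = N := by
  obtain ⟨h1, h2, h3, h4⟩ := hN
  rw [span_monomsA, Submodule.mem_span_range_iff_exists_fun] at h2
  rw [span_monomsB, Submodule.mem_span_range_iff_exists_fun] at h3
  rw [span_monomsC, Submodule.mem_span_range_iff_exists_fun] at h4
  obtain ⟨a, ha⟩ := h2
  obtain ⟨b, hb⟩ := h3
  obtain ⟨c, hc⟩ := h4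
  refine ⟨(a, b, c), ?_⟩
  funext x
  have ha := congrFun ha x
  have hb := congrFun hb x
  have hc := congrFun hc x
  have h10 : N x 1 0 = N x 0 1 := (h1 x).apply 0 1
  simp only [Finset.sum_apply, Pi.smul_apply, smul_eq_mul] at ha hb hc
  ext i j
  fin_cases i <;> fin_cases j <;> simp [refTensor, ha, hb, hc, h10]

section Components

variable (θ : Coeffs) (x : Plane)

theorem refTensor_zero_zero : refTensor θ x 0 0 =
    θ.1 0 + θ.1 1 * x 0 + θ.1 2 * x 1 + θ.1 3 * (x 0 * x 1) + θ.1 4 * x 0 ^ 2 +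
      θ.1 5 * x 0 ^ 3 := by
  simp [refTensor, monomsA, Fin.sum_univ_succ, monomial]
  ring

theorem refTensor_zero_one : refTensor θ x 0 1 =
    θ.2.1 0 + θ.2.1 1 * x 0 + θ.2.1 2 * x 1 + θ.2.1 3 * x 0 ^ 2 + θ.2.1 4 * (x 0 * x 1) +
      θ.2.1 5 * x 1 ^ 2 + θ.2.1 6 * (x 0 ^ 2 * x 1) + θ.2.1 7 * (x 0 * x 1 ^ 2) := by
  simp [refTensor, monomsB, Fin.sum_univ_succ, monomial]
  ring

theorem refTensor_one_one : refTensor θ x 1 1 =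
    θ.2.2 0 + θ.2.2 1 * x 0 + θ.2.2 2 * x 1 + θ.2.2 3 * (x 0 * x 1) + θ.2.2 4 * x 1 ^ 2 +
      θ.2.2 5 * x 1 ^ 3 := by
  simp [refTensor, monomsC, Fin.sum_univ_succ, monomial]
  ring

theorem pd_combination (i : Fin 2) {n : ℕ} (c : Fin n → ℝ) (m : Fin n → Plane → ℝ)
    (hm : ∀ k, Differentiable ℝ (m k)) :
    pd i (fun y => ∑ k, c k * m k y) x = ∑ k, c k * pd i (m k) x := by
  rw [pd_sum _ fun k _ => ((hm k).const_mul (c k)) x]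
  exact Finset.sum_congr rfl fun k _ => pd_const_mul (c k) (hm k x)

theorem differentiable_monomsA (k : Fin 6) : Differentiable ℝ (monomsA k) := by
  fin_cases k <;> exact differentiable_monomial _ _

theorem differentiable_monomsB (k : Fin 8) : Differentiable ℝ (monomsB k) := by
  fin_cases k <;> exact differentiable_monomial _ _

theorem differentiable_monomsC (k : Fin 6) : Differentiable ℝ (monomsC k) := by
  fin_cases k <;> exact differentiable_monomial _ _

theorem pd_zero_refTensor_zero_zero : pd 0 (fun y => refTensor θ y 0 0) x =
    θ.1 1 + θ.1 3 * x 1 + 2 * θ.1 4 * x 0 + 3 * θ.1 5 * x 0 ^ 2 := by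
  refine (pd_combination x 0 θ.1 monomsA differentiable_monomsA).trans ?_
  simp [monomsA, Fin.sum_univ_succ, pd_zero_monomial]
  ring

theorem pd_one_refTensor_zero_zero : pd 1 (fun y => refTensor θ y 0 0) x =
    θ.1 2 + θ.1 3 * x 0 := by
  refine (pd_combination x 1 θ.1 monomsA differentiable_monomsA).trans ?_
  simp [monomsA, Fin.sum_univ_succ, pd_one_monomial]

theorem pd_zero_refTensor_zero_one : pd 0 (fun y => refTensor θ y 0 1) x =
    θ.2.1 1 + 2 * θ.2.1 3 * x 0 + θ.2.1 4 * x 1 + 2 * θ.2.1 6 * (x 0 * x 1) +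
      θ.2.1 7 * x 1 ^ 2 := by
  refine (pd_combination x 0 θ.2.1 monomsB differentiable_monomsB).trans ?_
  simp [monomsB, Fin.sum_univ_succ, pd_zero_monomial]
  ring

theorem pd_one_refTensor_zero_one : pd 1 (fun y => refTensor θ y 0 1) x =
    θ.2.1 2 + θ.2.1 4 * x 0 + 2 * θ.2.1 5 * x 1 + θ.2.1 6 * x 0 ^ 2 +
      2 * θ.2.1 7 * (x 0 * x 1) := by
  refine (pd_combination x 1 θ.2.1 monomsB differentiable_monomsB).trans ?_
  simp [monomsB, Fin.sum_univ_succ, pd_one_monomial]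
  ring

theorem pd_zero_refTensor_one_one : pd 0 (fun y => refTensor θ y 1 1) x =
    θ.2.2 1 + θ.2.2 3 * x 1 := by
  refine (pd_combination x 0 θ.2.2 monomsC differentiable_monomsC).trans ?_
  simp [monomsC, Fin.sum_univ_succ, pd_zero_monomial]

theorem pd_one_refTensor_one_one : pd 1 (fun y => refTensor θ y 1 1) x =
    θ.2.2 2 + θ.2.2 3 * x 0 + 2 * θ.2.2 4 * x 1 + 3 * θ.2.2 5 * x 1 ^ 2 := by
  refine (pd_combination x 1 θ.2.2 monomsC differentiable_monomsC).trans ?_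
  simp [monomsC, Fin.sum_univ_succ, pd_one_monomial]
  ring

end Components

theorem SmoothTensor.differentiable {M : Plane → Tensor} (hM : SmoothTensor M) (i j : Fin 2) :
    Differentiable ℝ (fun x => M x i j) :=
  (hM i j).differentiable (by simp)

namespace Parallelogram

variable (K : Parallelogram)

/-! ### Transformation rules -/

/-- The linear part of the affine map of a parallelogram. -/
def lin : Plane →L[ℝ] Plane := (Matrix.toLpLin 2 2 K.B).toContinuousLinearMap

theorem lin_apply (v : Plane) (i : Fin 2) : K.lin v i = K.B i 0 * v 0 + K.B i 1 * v 1 := by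
  have h : (K.B *ᵥ v.ofLp) i = K.B i 0 * v 0 + K.B i 1 * v 1 := by
    rw [Matrix.mulVec, dotProduct, Fin.sum_univ_two]
  exact h

theorem hasFDerivAt_map (z : Plane) : HasFDerivAt K.map K.lin z := by
  have h : K.map = fun x => K.lin x + K.a := by
    funext x
    ext i
    rw [map_apply, PiLp.add_apply, lin_apply]
  rw [h]
  exact K.lin.hasFDerivAt.add_const K.a

theorem fderiv_comp_map {f : Plane → ℝ} {z : Plane} (hf : DifferentiableAt ℝ f (K.map z))
    (v : Plane) : fderiv ℝ (fun y => f (K.map y)) z v = fderiv ℝ f (K.map z) (K.lin v) := by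
  have h : HasFDerivAt (fun y => f (K.map y)) _ z := hf.hasFDerivAt.comp z (K.hasFDerivAt_map z)
  rw [h.fderiv]
  rfl

theorem pd_comp_map {f : Plane → ℝ} {z : Plane} (hf : DifferentiableAt ℝ f (K.map z))
    (k : Fin 2) :
    pd k (fun y => f (K.map y)) z =
      K.B 0 k * pd 0 f (K.map z) + K.B 1 k * pd 1 f (K.map z) := by
  rw [pd, K.fderiv_comp_map hf, fderiv_apply_eq_pd, lin_apply, lin_apply]
  fin_cases k <;> simp

theorem piola_map_apply (N : Plane → Tensor) (z : Plane) (i j : Fin 2) :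
    K.piola N (K.map z) i j = |K.B.det|⁻¹ *
      (K.B i 0 * K.B j 0 * N z 0 0 + K.B i 0 * K.B j 1 * N z 0 1 +
        K.B i 1 * K.B j 0 * N z 1 0 + K.B i 1 * K.B j 1 * N z 1 1) := by
  simp only [piola, LinearMap.coe_mk, AddHom.coe_mk, invMap_map, Matrix.smul_apply,
    Matrix.mul_apply, Fin.sum_univ_two, Matrix.transpose_apply, smul_eq_mul]
  ring

theorem pd_piola_map {N : Plane → Tensor} (hN : SmoothTensor N) (z : Plane) (i j k : Fin 2) :
    pd k (fun y => K.piola N (K.map y) i j) z = |K.B.det|⁻¹ *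
      (K.B i 0 * K.B j 0 * pd k (fun y => N y 0 0) z +
        K.B i 0 * K.B j 1 * pd k (fun y => N y 0 1) z +
        K.B i 1 * K.B j 0 * pd k (fun y => N y 1 0) z +
        K.B i 1 * K.B j 1 * pd k (fun y => N y 1 1) z) := by
  have h := fun p q => hN.differentiable p q
  have e : (fun y => K.piola N (K.map y) i j) = fun y => |K.B.det|⁻¹ *
      (K.B i 0 * K.B j 0 * N y 0 0 + K.B i 0 * K.B j 1 * N y 0 1 +
        K.B i 1 * K.B j 0 * N y 1 0 + K.B i 1 * K.B j 1 * N y 1 1) :=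
    funext fun y => K.piola_map_apply N y i j
  have d := fun (c : ℝ) p q => ((h p q).const_mul c) z
  rw [e, pd_const_mul, pd_add, pd_add, pd_add, pd_const_mul _ (h _ _ z), pd_const_mul _ (h _ _ z),
    pd_const_mul _ (h _ _ z), pd_const_mul _ (h _ _ z)]
  exacts [d _ _ _, d _ _ _, (d _ _ _).add (d _ _ _), d _ _ _,
    ((d _ _ _).add (d _ _ _)).add (d _ _ _), d _ _ _,
    (((d _ _ _).add (d _ _ _)).add (d _ _ _)).add (d _ _ _)]

theorem smooth_piola {N : Plane → Tensor} (hN : N ∈ refSpace) : SmoothTensor (K.piola N) :=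
  K.smooth_localSpace ⟨N, hN, rfl⟩

/-- The row-wise divergence is covariant: `|J| (div M) ∘ F = B div N` for the Piola transform `M`
of `N`. -/
theorem rowDiv_piola {N : Plane → Tensor} (hN : N ∈ refSpace) (z : Plane) (i : Fin 2) :
    rowDiv (K.piola N) (K.map z) i =
      |K.B.det|⁻¹ * (K.B i 0 * rowDiv N z 0 + K.B i 1 * rowDiv N z 1) := by
  have h : ∀ j k, K.B 0 k * pd 0 (fun y => K.piola N y i j) (K.map z) +
      K.B 1 k * pd 1 (fun y => K.piola N y i j) (K.map z) = _ := fun j k =>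
    (K.pd_comp_map ((K.smooth_piola hN).differentiable i j _) k).symm.trans
      (K.pd_piola_map (smooth_refSpace hN) z i j k)
  simp only [rowDiv, Fin.sum_univ_two]
  refine mul_left_cancel₀ K.det_ne_zero ?_
  generalize |K.B.det|⁻¹ = r at h ⊢
  rw [Matrix.det_fin_two]
  linear_combination K.B 1 1 * h 0 0 - K.B 1 0 * h 0 1 - K.B 0 1 * h 1 0 + K.B 0 0 * h 1 1

theorem len_sq (j : Fin 4) :
    K.len j ^ 2 = 4 * (K.B 0 (sideIdx (j + 1)) ^ 2 + K.B 1 (sideIdx (j + 1)) ^ 2) := by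
  rw [← norm_sq_vertex_sub]
  simp only [vertex, map_apply]
  fin_cases j <;> simp [refVertex, sideIdx] <;> ring

/-- The amount of the normal-normal trace of the reference tensor that enters the tangential-normal
trace of its Piola transform; it vanishes for rectangles. -/
def skew (j : Fin 4) : ℝ := 4 * (K.B 0 0 * K.B 0 1 + K.B 1 0 * K.B 1 1) / K.len j ^ 2

theorem orient_eq : K.orient = K.B.det / |K.B.det| := by
  rw [eq_div_iff (abs_pos.mpr K.det_ne_zero).ne']
  have h := K.orient_mul_self
  rw [← orient_mul_det]
  linear_combination K.B.det * h

theorem trM_piola {N : Plane → Tensor} (hN : N ∈ refSpace) (j : Fin 4) (z : Plane) :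
    K.trM j (K.piola N) (K.map z) =
      4 * |K.B.det| / K.len j ^ 2 * N z (sideIdx j) (sideIdx j) := by
  have h10 : N z 1 0 = N z 0 1 := (hN.1 z).apply 0 1
  have ho := K.orient_mul_self
  have hl := (K.len_pos j).ne'
  have hd := (abs_pos.mpr K.det_ne_zero).ne'
  have e : K.trM j (K.piola N) (K.map z) = K.orient * K.orient *
      (4 * K.B.det ^ 2 / |K.B.det|) / K.len j ^ 2 * N z (sideIdx j) (sideIdx j) := by
    simp only [trM, dotProduct, Matrix.mulVec, Fin.sum_univ_two, normal_apply_zero,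
      normal_apply_one, tangent_apply, piola_map_apply, h10]
    rw [K.B.det_fin_two]
    fin_cases j <;> simp [refVertex, sideIdx] <;> field_simp <;> ring
  rw [e, ho, ← sq_abs K.B.det]
  field_simp

/-- The sign of `b = N₀₁` in the tangential-normal trace of `N` on the `j`-th edge of the reference
square. -/
def tnSign : Fin 4 → ℝ := ![-1, 1, -1, 1]

theorem tn_piola {N : Plane → Tensor} (hN : N ∈ refSpace) (j : Fin 4) (z : Plane) :
    K.tn j (K.piola N) (K.map z) =
      K.orient * tnSign j * (N z 0 1 + K.skew j * N z (sideIdx j) (sideIdx j)) := by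
  have h10 : N z 1 0 = N z 0 1 := (hN.1 z).apply 0 1
  have ho := K.orient_mul_self
  have hl := (K.len_pos j).ne'
  have hd := (abs_pos.mpr K.det_ne_zero).ne'
  have hs := K.len_sq j
  have e : K.tn j (K.piola N) (K.map z) = K.orient * K.orient *
      (K.B.det / |K.B.det| * tnSign j) *
        (4 * (K.B 0 (sideIdx (j + 1)) ^ 2 + K.B 1 (sideIdx (j + 1)) ^ 2) / K.len j ^ 2 * N z 0 1
          + K.skew j * N z (sideIdx j) (sideIdx j)) := by
    simp only [tn, dotProduct, Matrix.mulVec, Fin.sum_univ_two, normal_apply_zero,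
      normal_apply_one, tangent_apply, piola_map_apply, h10, skew]
    rw [K.B.det_fin_two]
    fin_cases j <;> simp [refVertex, sideIdx, tnSign] <;> field_simp <;> ring
  rw [e, ho, ← hs, div_self (pow_ne_zero 2 hl), ← orient_eq]
  ring

theorem trq_piola {N : Plane → Tensor} (hN : N ∈ refSpace) (j : Fin 4) (z : Plane) :
    K.trq j (K.piola N) (K.map z) = 2 * sideSign j / K.len j *
      (pd (sideIdx j) (fun y => N y (sideIdx j) (sideIdx j)) z +
        2 * pd (sideIdx (j + 1)) (fun y => N y 0 1) z +
        K.skew j * pd (sideIdx (j + 1)) (fun y => N y (sideIdx j) (sideIdx j)) z) := by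
  have h10 : (fun y => N y 1 0) = fun y => N y 0 1 := funext fun y => (hN.1 y).apply 0 1
  have hsm := smooth_refSpace hN
  have hl := (K.len_pos j).ne'
  have ho := K.orient_mul_self
  have hd := (abs_pos.mpr K.det_ne_zero).ne'
  -- the tangential derivative
  have hp : ∀ k, pd k (fun y => K.tn j (K.piola N) (K.map y)) z = K.orient * tnSign j *
      (pd k (fun y => N y 0 1) z + K.skew j * pd k (fun y => N y (sideIdx j) (sideIdx j)) z) := by
    intro k
    have d1 := hsm.differentiable 0 1 z
    have d2 := hsm.differentiable (sideIdx j) (sideIdx j) z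
    simp only [K.tn_piola hN]
    rw [pd_const_mul _ (d1.fun_add (d2.const_mul _)), pd_add d1 (d2.const_mul _),
      pd_const_mul _ d2]
  have hq : ∀ k, pd k (fun y => K.tn j (K.piola N) (K.map y)) z = _ := fun k =>
    K.pd_comp_map (((contDiff_tn j (K.smooth_piola hN)).differentiable (by simp)) _) k
  have ht : fderiv ℝ (K.tn j (K.piola N)) (K.map z) (K.tangent j) =
      2 * sideSign j / K.len j * (pd (sideIdx (j + 1)) (fun y => N y 0 1) z +
        K.skew j * pd (sideIdx (j + 1)) (fun y => N y (sideIdx j) (sideIdx j)) z) := by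
    have e : fderiv ℝ (K.tn j (K.piola N)) (K.map z) (K.tangent j) =
        K.orient / K.len j * (2 * tnSign j * sideSign j *
          pd (sideIdx (j + 1)) (fun y => K.tn j (K.piola N) (K.map y)) z) := by
      rw [fderiv_apply_eq_pd, tangent_apply, tangent_apply, hq]
      fin_cases j <;> simp [refVertex, sideIdx, sideSign, tnSign] <;> ring
    have hs : tnSign j * tnSign j = 1 := by fin_cases j <;> simp [tnSign]
    rw [e, hp]
    linear_combination (2 * sideSign j / K.len j * (pd (sideIdx (j + 1)) (fun y => N y 0 1) z +
      K.skew j * pd (sideIdx (j + 1)) (fun y => N y (sideIdx j) (sideIdx j)) z)) *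
      (tnSign j * tnSign j * ho + hs)
  -- the normal component of the divergence
  have hn : (K.normal j).ofLp ⬝ᵥ rowDiv (K.piola N) (K.map z) =
      2 * sideSign j / K.len j * rowDiv N z (sideIdx j) := by
    have e : (K.normal j).ofLp ⬝ᵥ rowDiv (K.piola N) (K.map z) =
        K.orient * (K.B.det / |K.B.det|) * (2 * sideSign j / K.len j * rowDiv N z (sideIdx j)) := by
      simp only [dotProduct, Fin.sum_univ_two, normal_apply_zero, normal_apply_one, tangent_apply,
        K.rowDiv_piola hN]
      rw [K.B.det_fin_two]
      fin_cases j <;> simp [refVertex, sideIdx, sideSign] <;> field_simp <;> ring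
    rw [e, ← orient_eq, ho, one_mul]
  have hr : rowDiv N z (sideIdx j) = pd (sideIdx j) (fun y => N y (sideIdx j) (sideIdx j)) z +
      pd (sideIdx (j + 1)) (fun y => N y 0 1) z := by
    fin_cases j <;> simp [rowDiv, Fin.sum_univ_two, sideIdx, h10, add_comm]
  rw [trq, ht, hn, hr]
  ring

theorem jump_eq (j : Fin 4) (M : Plane → Tensor) :
    K.jump j M = K.orient * (K.tn (j - 1) M (K.vertex j) - K.tn j M (K.vertex j)) := by
  unfold jump orient
  split_ifs <;> ring

end Parallelogram

theorem integral_quadratic (a b c : ℝ) :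
    ∫ s in (0 : ℝ)..1, (a + s * b + s ^ 2 * c) = a + b / 2 + c / 3 := by
  have h : ∀ s ∈ uIcc (0 : ℝ) 1, HasDerivAt (fun s => a * s + b * (s ^ 2 / 2) + c * (s ^ 3 / 3))
      (a + s * b + s ^ 2 * c) s := by
    intro s _
    have h1 := (hasDerivAt_id s).const_mul a
    have h2 := ((hasDerivAt_pow 2 s).div_const 2).const_mul b
    have h3 := ((hasDerivAt_pow 3 s).div_const 3).const_mul c
    refine ((h1.add h2).add h3).congr_deriv ?_
    norm_num
    ring
  rw [intervalIntegral.integral_eq_sub_of_hasDerivAt h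
    (Continuous.intervalIntegrable (by fun_prop) _ _)]
  ring

namespace Parallelogram

variable (K : Parallelogram)

/-! ### Traces and moments on the edges -/

/-- `f` restricted to the `j`-th edge is a polynomial of degree at most one. -/
def AffineOnEdge (j : Fin 4) (f : Plane → ℝ) : Prop :=
  ∀ s, f (K.edgePt j s) = (1 - s) * f (K.edgePt j 0) + s * f (K.edgePt j 1)

variable {K}

theorem AffineOnEdge.add {j : Fin 4} {f g : Plane → ℝ} (hf : K.AffineOnEdge j f)
    (hg : K.AffineOnEdge j g) : K.AffineOnEdge j (fun x => f x + g x) := by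
  intro s
  simp only
  rw [hf s, hg s]
  ring

theorem AffineOnEdge.sub {j : Fin 4} {f g : Plane → ℝ} (hf : K.AffineOnEdge j f)
    (hg : K.AffineOnEdge j g) : K.AffineOnEdge j (fun x => f x - g x) := by
  intro s
  simp only
  rw [hf s, hg s]
  ring

theorem AffineOnEdge.of_edge_eq {K' : Parallelogram} {j j' : Fin 4}
    (h : K.edge j = K'.edge j') {f : Plane → ℝ} (hf : K.AffineOnEdge j f) :
    K'.AffineOnEdge j' f := by
  intro s
  rcases edgePt_of_edge_eq h with e | e
  · rw [e, e, e, hf s]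
  · rw [e, e, e, hf (1 - s), sub_zero, sub_self]
    ring

variable (K)

theorem affineOnEdge_affineMap (j : Fin 4) (l : Plane →ᵃ[ℝ] ℝ) : K.AffineOnEdge j l := by
  intro s
  have h : ∀ s, l (K.edgePt j s) = (1 - s) * l (K.vertex j) + s * l (K.vertex (j + 1)) := by
    intro s
    rw [edgePt, AffineMap.apply_lineMap, AffineMap.lineMap_apply_module, smul_eq_mul, smul_eq_mul]
  rw [h s, edgePt_zero, edgePt_one]

theorem affineOnEdge_trM (j : Fin 4) {M : Plane → Tensor} (hM : M ∈ K.localSpace) :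
    K.AffineOnEdge j (K.trM j M) := by
  obtain ⟨N, hN, rfl⟩ := hM
  obtain ⟨θ, rfl⟩ := exists_refTensor hN
  intro s
  simp only [edgePt_eq_map, K.trM_piola hN]
  fin_cases j <;>
    simp [sideIdx, refTensor_zero_zero, refTensor_one_one, refEdgePt_apply, refVertex] <;> ring

theorem affineOnEdge_trq (j : Fin 4) {M : Plane → Tensor} (hM : M ∈ K.localSpace) :
    K.AffineOnEdge j (K.trq j M) := by
  obtain ⟨N, hN, rfl⟩ := hM
  obtain ⟨θ, rfl⟩ := exists_refTensor hN
  intro s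
  simp only [edgePt_eq_map, K.trq_piola hN]
  fin_cases j <;>
    simp [sideIdx, sideSign, pd_zero_refTensor_zero_zero, pd_one_refTensor_zero_zero,
      pd_zero_refTensor_zero_one, pd_one_refTensor_zero_one,
      pd_zero_refTensor_one_one, pd_one_refTensor_one_one, refEdgePt_apply, refVertex] <;> ring

variable {K}

/-- An affine function on an edge vanishes if its moments against `1` and against one nonconstant
affine function vanish. -/
theorem AffineOnEdge.eq_zero_of_moments {j : Fin 4} {f : Plane → ℝ} (hf : K.AffineOnEdge j f)
    {l : Plane →ᵃ[ℝ] ℝ} (hl : ∃ x ∈ K.edge j, ∃ y ∈ K.edge j, l x ≠ l y)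
    (h0 : K.edgeIntegral j f = 0) (h1 : K.edgeIntegral j (fun x => f x * l x) = 0) (s : ℝ) :
    f (K.edgePt j s) = 0 := by
  have hl' := K.affineOnEdge_affineMap j l
  have hne : l (K.edgePt j 0) ≠ l (K.edgePt j 1) := by
    intro he
    obtain ⟨x, hx, y, hy, hxy⟩ := hl
    rw [edge_eq_image] at hx hy
    obtain ⟨p, -, rfl⟩ := hx
    obtain ⟨q, -, rfl⟩ := hy
    apply hxy
    rw [hl' p, hl' q, he]
    ring
  rw [edgeIntegral_eq, mul_eq_zero_iff_left (K.len_pos j).ne'] at h0 h1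
  have h0 : ∫ s in (0 : ℝ)..1, ((1 - s) * f (K.edgePt j 0) + s * f (K.edgePt j 1)) = 0 :=
    (intervalIntegral.integral_congr fun s _ => (hf s).symm).trans h0
  have h1 : ∫ s in (0 : ℝ)..1, ((1 - s) * f (K.edgePt j 0) + s * f (K.edgePt j 1)) *
      ((1 - s) * l (K.edgePt j 0) + s * l (K.edgePt j 1)) = 0 :=
    (intervalIntegral.integral_congr fun s _ => (congrArg₂ (· * ·) (hf s) (hl' s)).symm).trans h1
  rw [hf s]
  generalize f (K.edgePt j 0) = p at h0 h1 ⊢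
  generalize f (K.edgePt j 1) = q at h0 h1 ⊢
  generalize l (K.edgePt j 0) = a at h1 hne
  generalize l (K.edgePt j 1) = b at h1 hne
  have i0 : ∫ s in (0 : ℝ)..1, ((1 - s) * p + s * q) = (p + q) / 2 := by
    have e : (fun s : ℝ => (1 - s) * p + s * q) = fun s => p + s * (q - p) + s ^ 2 * 0 := by
      funext s
      ring
    rw [e, integral_quadratic]
    ring
  have i1 : ∫ s in (0 : ℝ)..1, ((1 - s) * p + s * q) * ((1 - s) * a + s * b) =
      (2 * p * a + p * b + q * a + 2 * q * b) / 6 := by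
    have e : (fun s : ℝ => ((1 - s) * p + s * q) * ((1 - s) * a + s * b)) = fun s =>
        p * a + s * (p * (b - a) + (q - p) * a) + s ^ 2 * ((q - p) * (b - a)) := by
      funext s
      ring
    rw [e, integral_quadratic]
    ring
  rw [i0] at h0
  rw [i1] at h1
  obtain rfl : q = - p := by linarith
  have h2 : p * (a - b) = 0 := by linarith
  rcases mul_eq_zero.mp h2 with h3 | h3
  · rw [h3]
    ring
  · exact absurd (sub_eq_zero.mp h3) hne

variable (K)

/-- Unisolvence of the traces and jumps on the local space, in terms of coefficients. The
normal-normal traces control the diagonal entries at the boundary, so that the terms with `skew`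
disappear from the shear forces and the jumps. -/
theorem coeffs_eq_zero {θ : Coeffs} (hM : ∀ j s, K.trM j (K.piola (refTensor θ)) (K.edgePt j s) = 0)
    (hq : ∀ j s, K.trq j (K.piola (refTensor θ)) (K.edgePt j s) = 0)
    (hJ : ∀ j, K.jump j (K.piola (refTensor θ)) = 0) : θ = 0 := by
  have hN := refTensor_mem θ
  -- everything is expressed on the reference square
  have hM' : ∀ j s, refTensor θ (refEdgePt j s) (sideIdx j) (sideIdx j) = 0 := by
    intro j s
    have h := hM j s
    rw [edgePt_eq_map, K.trM_piola hN] at h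
    refine (mul_eq_zero.mp h).resolve_left ?_
    have := abs_pos.mpr K.det_ne_zero
    have := K.len_pos j
    positivity
  have hq' : ∀ j s, pd (sideIdx j) (fun y => refTensor θ y (sideIdx j) (sideIdx j))
      (refEdgePt j s) + 2 * pd (sideIdx (j + 1)) (fun y => refTensor θ y 0 1) (refEdgePt j s) +
      K.skew j * pd (sideIdx (j + 1)) (fun y => refTensor θ y (sideIdx j) (sideIdx j))
        (refEdgePt j s) = 0 := by
    intro j s
    have h := hq j s
    rw [edgePt_eq_map, K.trq_piola hN] at h
    refine (mul_eq_zero.mp h).resolve_left ?_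
    have := (K.len_pos j).ne'
    fin_cases j <;> simp [sideSign] <;> exact this
  have hJ' : ∀ j, refTensor θ (refVertex j) 0 1 = 0 := by
    intro j
    have h := hJ j
    have e0 := hM' j 0
    have e1 := hM' (j - 1) 1
    rw [refEdgePt, AffineMap.lineMap_apply_zero] at e0
    rw [refEdgePt, AffineMap.lineMap_apply_one, sub_add_cancel] at e1
    rw [jump_eq, vertex, K.tn_piola hN, K.tn_piola hN, e0, e1] at h
    have ho := K.orient_mul_self
    have hs : tnSign (j - 1) = - tnSign j ∧ tnSign j * tnSign j = 1 := by
      fin_cases j <;> simp [tnSign]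
    rw [hs.1] at h
    linear_combination (-1 / 2 * tnSign j) * h
      - refTensor θ (refVertex j) 0 1 * (hs.2 + tnSign j * tnSign j * ho)
  have a1 := hM' 1 0
  have a2 := hM' 1 1
  have a3 := hM' 3 0
  have a4 := hM' 3 1
  have c1 := hM' 0 0
  have c2 := hM' 0 1
  have c3 := hM' 2 0
  have c4 := hM' 2 1
  simp [sideIdx, refTensor_zero_zero, refTensor_one_one, refEdgePt_apply, refVertex]
    at a1 a2 a3 a4 c1 c2 c3 c4
  have ha2 : θ.1 2 = 0 := by linarith
  have ha3 : θ.1 3 = 0 := by linarith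
  have hc1 : θ.2.2 1 = 0 := by linarith
  have hc3 : θ.2.2 3 = 0 := by linarith
  have q1 := hq' 0 0
  have q2 := hq' 0 1
  have q3 := hq' 1 0
  have q4 := hq' 1 1
  have q5 := hq' 2 0
  have q6 := hq' 2 1
  have q7 := hq' 3 0
  have q8 := hq' 3 1
  simp [sideIdx, pd_zero_refTensor_zero_zero, pd_one_refTensor_zero_zero,
      pd_zero_refTensor_zero_one, pd_one_refTensor_zero_one, ha2, ha3, hc1, hc3,
      pd_zero_refTensor_one_one, pd_one_refTensor_one_one, refEdgePt_apply, refVertex]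
    at q1 q2 q3 q4 q5 q6 q7 q8
  have j0 := hJ' 0
  have j1 := hJ' 1
  have j2 := hJ' 2
  have j3 := hJ' 3
  simp [refTensor_zero_one, refVertex] at j0 j1 j2 j3
  refine Prod.ext ?_ (Prod.ext ?_ ?_)
  · funext k
    fin_cases k <;> simp <;> linarith
  · funext k
    fin_cases k <;> simp <;> linarith
  · funext k
    fin_cases k <;> simp <;> linarith

/-! ### Local degrees of freedom -/

/-- The moment of the normal-normal trace on the `j`-th edge against an affine function. -/
def momM (j : Fin 4) (l : Plane →ᵃ[ℝ] ℝ) : K.localSpace →ₗ[ℝ] ℝ where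
  toFun M := K.edgeIntegral j (fun x => K.trM j M x * l x)
  map_add' M N := by
    have hl : Continuous l := l.continuous_of_finiteDimensional
    have cM := continuous_trM (K := K) j (K.smooth_localSpace M.2)
    have cN := continuous_trM (K := K) j (K.smooth_localSpace N.2)
    refine Eq.trans ?_ (K.edgeIntegral_add j (cM.mul hl) (cN.mul hl))
    congr 1
    funext x
    simp only [Submodule.coe_add, trM_add, Pi.add_apply]
    ring
  map_smul' c M := by
    refine Eq.trans ?_ (K.edgeIntegral_smul j c _)
    congr 1
    funext x
    simp only [Submodule.coe_smul, trM_smul, Pi.smul_apply, smul_eq_mul]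
    ring

/-- The moment of the effective shear force on the `j`-th edge against an affine function. -/
def momQ (j : Fin 4) (l : Plane →ᵃ[ℝ] ℝ) : K.localSpace →ₗ[ℝ] ℝ where
  toFun M := K.edgeIntegral j (fun x => K.trq j M x * l x)
  map_add' M N := by
    have hl : Continuous l := l.continuous_of_finiteDimensional
    have sM := K.smooth_localSpace M.2
    have sN := K.smooth_localSpace N.2
    have cM := continuous_trq (K := K) j sM
    have cN := continuous_trq (K := K) j sN
    refine Eq.trans ?_ (K.edgeIntegral_add j (cM.mul hl) (cN.mul hl))
    congr 1
    funext x
    simp only [Submodule.coe_add, trq_add j sM sN, Pi.add_apply]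
    ring
  map_smul' c M := by
    refine Eq.trans ?_ (K.edgeIntegral_smul j c _)
    congr 1
    funext x
    simp only [Submodule.coe_smul, trq_smul j c (K.smooth_localSpace M.2), Pi.smul_apply,
      smul_eq_mul]
    ring

/-- The jump of the tangential-normal trace at the `j`-th vertex. -/
def jumpL (j : Fin 4) : K.localSpace →ₗ[ℝ] ℝ where
  toFun M := K.jump j M
  map_add' _ _ := jump_add j
  map_smul' c _ := jump_smul j c

/-- All degrees of freedom of the local space: four moments per edge (the affine functions `1` and
`l j` on the `j`-th edge) and one jump per vertex. -/
def dofs (l : Fin 4 → (Plane →ᵃ[ℝ] ℝ)) :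
    K.localSpace →ₗ[ℝ] Fin 4 → ℝ × ℝ × ℝ × ℝ × ℝ :=
  LinearMap.pi fun j => (K.momM j (AffineMap.const ℝ Plane 1)).prod <|
    (K.momM j (l j)).prod <| (K.momQ j (AffineMap.const ℝ Plane 1)).prod <|
      (K.momQ j (l j)).prod (K.jumpL j)

/-- Injectivity is unisolvence; surjectivity follows since the space of coefficients and the space of
values both have dimension `20`. -/
theorem dofs_bijective {l : Fin 4 → (Plane →ᵃ[ℝ] ℝ)}
    (hl : ∀ j, ∃ x ∈ K.edge j, ∃ y ∈ K.edge j, l j x ≠ l j y) :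
    Function.Bijective (K.dofs l) := by
  let P : Coeffs →ₗ[ℝ] K.localSpace :=
    (K.piola ∘ₗ refTensor).codRestrict K.localSpace fun θ => ⟨_, refTensor_mem θ, rfl⟩
  have hP : Function.Surjective P := by
    rintro ⟨M, N, hN, rfl⟩
    obtain ⟨θ, rfl⟩ := exists_refTensor hN
    exact ⟨θ, rfl⟩
  have hinj : Function.Injective (K.dofs l ∘ₗ P) := by
    rw [injective_iff_map_eq_zero]
    intro θ hθ
    have h : ∀ j, K.dofs l (P θ) j = 0 := fun j => congrFun hθ j
    have hm0 : ∀ j, K.edgeIntegral j (fun x => K.trM j (P θ) x * 1) = 0 := fun j =>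
      congrArg (fun t => t.1) (h j)
    have hm1 : ∀ j, K.edgeIntegral j (fun x => K.trM j (P θ) x * l j x) = 0 := fun j =>
      congrArg (fun t => t.2.1) (h j)
    have hq0 : ∀ j, K.edgeIntegral j (fun x => K.trq j (P θ) x * 1) = 0 := fun j =>
      congrArg (fun t => t.2.2.1) (h j)
    have hq1 : ∀ j, K.edgeIntegral j (fun x => K.trq j (P θ) x * l j x) = 0 := fun j =>
      congrArg (fun t => t.2.2.2.1) (h j)
    have hJ : ∀ j, K.jump j (P θ) = 0 := fun j => congrArg (fun t => t.2.2.2.2) (h j)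
    simp only [mul_one] at hm0 hq0
    exact K.coeffs_eq_zero
      (fun j => (K.affineOnEdge_trM j (P θ).2).eq_zero_of_moments (hl j) (hm0 j) (hm1 j))
      (fun j => (K.affineOnEdge_trq j (P θ).2).eq_zero_of_moments (hl j) (hq0 j) (hq1 j)) hJ
  have hdim : Module.finrank ℝ Coeffs = Module.finrank ℝ (Fin 4 → ℝ × ℝ × ℝ × ℝ × ℝ) := by
    simp [Module.finrank_prod, Module.finrank_pi_fintype]
  have hsurj := (LinearMap.injective_iff_surjective_of_finrank_eq_finrank hdim).mp hinj
  refine ⟨?_, .of_comp hsurj⟩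
  intro x y hxy
  obtain ⟨θ, rfl⟩ := hP x
  obtain ⟨η, rfl⟩ := hP y
  rw [hinj hxy]

end Parallelogram

/-! ### The divergence theorem on a parallelogram -/

theorem integral_refSquare (f : Plane → ℝ) :
    ∫ x in refSquare, f x = ∫ p in Ioo (-1 : ℝ) 1 ×ˢ Ioo (-1 : ℝ) 1, f !₂[p.1, p.2] := by
  let e : (ℝ × ℝ) ≃ᵐ Plane :=
    MeasurableEquiv.finTwoArrow.symm.trans (MeasurableEquiv.toLp 2 (Fin 2 → ℝ))
  have he : MeasurePreserving e :=
    (volume_preserving_finTwoArrow ℝ).symm.trans (PiLp.volume_preserving_toLp (Fin 2))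
  have hs : e ⁻¹' refSquare = Ioo (-1 : ℝ) 1 ×ˢ Ioo (-1 : ℝ) 1 := by
    ext p
    have h0 : e p 0 = p.1 := rfl
    have h1 : e p 1 = p.2 := rfl
    simp only [mem_preimage, refSquare, mem_ofPred_eq, Fin.forall_fin_two, h0, h1, abs_lt,
      mem_prod, mem_Ioo]
  rw [← he.setIntegral_preimage_emb e.measurableEmbedding, hs]
  rfl

theorem contDiff_pair : ContDiff ℝ ∞ fun p : ℝ × ℝ => (!₂[p.1, p.2] : Plane) := by
  rw [contDiff_piLp]
  intro i
  fin_cases i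
  · exact contDiff_fst
  · exact contDiff_snd

theorem hasFDerivAt_comp_pair {f : Plane → ℝ} (hf : Differentiable ℝ f) (p : ℝ × ℝ) :
    HasFDerivAt (fun p : ℝ × ℝ => f !₂[p.1, p.2])
      (pd 0 f !₂[p.1, p.2] • ContinuousLinearMap.fst ℝ ℝ ℝ +
        pd 1 f !₂[p.1, p.2] • ContinuousLinearMap.snd ℝ ℝ ℝ) p := by
  let L : ℝ × ℝ →L[ℝ] Plane :=
    (ContinuousLinearMap.fst ℝ ℝ ℝ).smulRight (EuclideanSpace.single 0 (1 : ℝ) : Plane) +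
      (ContinuousLinearMap.snd ℝ ℝ ℝ).smulRight (EuclideanSpace.single 1 (1 : ℝ) : Plane)
  have h : HasFDerivAt (fun p : ℝ × ℝ => (!₂[p.1, p.2] : Plane)) L p := by
    have e : (fun p : ℝ × ℝ => (!₂[p.1, p.2] : Plane)) = L := by
      funext p
      refine Plane.ext ?_ ?_ <;> simp [L]
    rw [e]
    exact L.hasFDerivAt
  refine ((hf _).hasFDerivAt.comp p h).congr_fderiv ?_
  ext <;> simp [pd, L]

theorem integral_refSquare_div {f g : Plane → ℝ} (hf : ContDiff ℝ ∞ f) (hg : ContDiff ℝ ∞ g) :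
    ∫ x in refSquare, (pd 0 f x + pd 1 g x) =
      (∫ x in (-1 : ℝ)..1, g !₂[x, 1]) - (∫ x in (-1 : ℝ)..1, g !₂[x, -1]) +
        (∫ y in (-1 : ℝ)..1, f !₂[1, y]) - ∫ y in (-1 : ℝ)..1, f !₂[-1, y] := by
  have hpd : ∀ i {h : Plane → ℝ}, ContDiff ℝ ∞ h → Continuous (pd i h) := fun i h hh =>
    (hh.continuous_fderiv (by simp)).clm_apply continuous_const
  have hc : Continuous fun p : ℝ × ℝ => pd 0 f !₂[p.1, p.2] + pd 1 g !₂[p.1, p.2] :=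
    ((hpd 0 hf).comp contDiff_pair.continuous).add ((hpd 1 hg).comp contDiff_pair.continuous)
  have hI : IntegrableOn (fun p : ℝ × ℝ => pd 0 f !₂[p.1, p.2] + pd 1 g !₂[p.1, p.2])
      (Icc (-1 : ℝ) 1 ×ˢ Icc (-1 : ℝ) 1) :=
    hc.continuousOn.integrableOn_compact (isCompact_Icc.prod isCompact_Icc)
  have key := integral2_divergence_prod_of_hasFDerivAt (fun p : ℝ × ℝ => f !₂[p.1, p.2])
    (fun p : ℝ × ℝ => g !₂[p.1, p.2]) _ _ (-1) (-1) 1 1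
    (hf.continuous.comp contDiff_pair.continuous).continuousOn
    (hg.continuous.comp contDiff_pair.continuous).continuousOn
    (fun p _ => hasFDerivAt_comp_pair (hf.differentiable (by simp)) p)
    (fun p _ => hasFDerivAt_comp_pair (hg.differentiable (by simp)) p)
    (by
      rw [uIcc_of_le (by norm_num)]
      simpa using hI)
  rw [integral_refSquare, Measure.volume_eq_prod,
    setIntegral_prod _ (hI.mono_set (prod_mono Ioo_subset_Icc_self Ioo_subset_Icc_self))]
  rw [← key, intervalIntegral.integral_of_le (by norm_num), integral_Ioc_eq_integral_Ioo]
  refine setIntegral_congr_fun measurableSet_Ioo fun x _ => ?_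
  simp only
  rw [intervalIntegral.integral_of_le (by norm_num), integral_Ioc_eq_integral_Ioo]
  simp

theorem integral_symm_interval (f : ℝ → ℝ) :
    ∫ x in (-1 : ℝ)..1, f x = 2 * ∫ s in (0 : ℝ)..1, f (2 * s - 1) := by
  have h := intervalIntegral.mul_integral_comp_mul_sub (f := f) (a := 0) (b := 1) 2 1
  rw [h]
  norm_num

theorem integral_symm_interval_neg (f : ℝ → ℝ) :
    ∫ x in (-1 : ℝ)..1, f x = 2 * ∫ s in (0 : ℝ)..1, f (1 - 2 * s) := by
  have h := intervalIntegral.mul_integral_comp_sub_mul (f := f) (a := 0) (b := 1) 2 1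
  rw [h]
  norm_num

namespace Parallelogram

theorem refEdgePt_zero (s : ℝ) : refEdgePt 0 s = !₂[2 * s - 1, -1] := by
  refine Plane.ext ?_ ?_
  · simp [refEdgePt_apply, refVertex]
    ring
  · simp [refEdgePt_apply, refVertex]

theorem refEdgePt_one (s : ℝ) : refEdgePt 1 s = !₂[1, 2 * s - 1] := by
  refine Plane.ext ?_ ?_
  · simp [refEdgePt_apply, refVertex]
  · simp [refEdgePt_apply, refVertex]
    ring

theorem refEdgePt_two (s : ℝ) : refEdgePt 2 s = !₂[1 - 2 * s, 1] := by
  refine Plane.ext ?_ ?_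
  · simp [refEdgePt_apply, refVertex]
    ring
  · simp [refEdgePt_apply, refVertex]

theorem refEdgePt_three (s : ℝ) : refEdgePt 3 s = !₂[-1, 1 - 2 * s] := by
  refine Plane.ext ?_ ?_
  · simp [refEdgePt_apply, refVertex]
  · simp [refEdgePt_apply, refVertex]
    ring

variable (K : Parallelogram)

theorem contDiff_map : ContDiff ℝ ∞ K.map := by
  rw [contDiff_piLp]
  intro i
  simp only [map_apply]
  fun_prop

theorem integral_carrier (f : Plane → ℝ) :
    ∫ x in K.carrier, f x = |K.B.det| * ∫ z in refSquare, f (K.map z) := by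
  have hm : MeasurableSet refSquare := by
    have : refSquare = ⋂ i : Fin 2, {x : Plane | |x i| < 1} := by
      ext x
      simp [refSquare]
    rw [this]
    refine MeasurableSet.iInter fun i => (isOpen_lt ?_ continuous_const).measurableSet
    fun_prop
  have hdet : K.lin.det = K.B.det := by
    rw [ContinuousLinearMap.det, lin]
    exact LinearMap.det_toLpLin 2 K.B
  rw [carrier, integral_image_eq_integral_abs_det_fderiv_smul volume hm
    (fun z _ => (K.hasFDerivAt_map z).hasFDerivWithinAt) K.map_injective.injOn, hdet]
  simp only [smul_eq_mul]
  rw [integral_const_mul]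

/-- The divergence theorem on a parallelogram. -/
theorem integral_div {v w : Plane → ℝ} (hv : ContDiff ℝ ∞ v) (hw : ContDiff ℝ ∞ w) :
    ∫ x in K.carrier, (pd 0 v x + pd 1 w x) =
      ∑ j, K.edgeIntegral j (fun x => K.normal j 0 * v x + K.normal j 1 * w x) := by
  -- The Piola transform of `(v, w)` on the reference square, multiplied by `|J|`.
  let f : Plane → ℝ := fun z => K.orient * (K.B 1 1 * v (K.map z) - K.B 0 1 * w (K.map z))
  let g : Plane → ℝ := fun z => K.orient * (K.B 0 0 * w (K.map z) - K.B 1 0 * v (K.map z))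
  have hv' : ContDiff ℝ ∞ fun z => v (K.map z) := hv.comp K.contDiff_map
  have hw' : ContDiff ℝ ∞ fun z => w (K.map z) := hw.comp K.contDiff_map
  have hf : ContDiff ℝ ∞ f :=
    contDiff_const.mul ((contDiff_const.mul hv').sub (contDiff_const.mul hw'))
  have hg : ContDiff ℝ ∞ g :=
    contDiff_const.mul ((contDiff_const.mul hw').sub (contDiff_const.mul hv'))
  have hdiv : ∀ z, |K.B.det| * (pd 0 v (K.map z) + pd 1 w (K.map z)) = pd 0 f z + pd 1 g z := by
    intro z
    have dv : DifferentiableAt ℝ (fun z => v (K.map z)) z := hv'.differentiable (by simp) z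
    have dw : DifferentiableAt ℝ (fun z => w (K.map z)) z := hw'.differentiable (by simp) z
    have ev := K.pd_comp_map (hv.differentiable (by simp) (K.map z))
    have ew := K.pd_comp_map (hw.differentiable (by simp) (K.map z))
    rw [pd_const_mul _ ((dv.const_mul _).fun_sub (dw.const_mul _)),
      pd_const_mul _ ((dw.const_mul _).fun_sub (dv.const_mul _)),
      pd_sub (dv.const_mul _) (dw.const_mul _), pd_sub (dw.const_mul _) (dv.const_mul _),
      pd_const_mul _ dv, pd_const_mul _ dv, pd_const_mul _ dw, pd_const_mul _ dw,
      ev, ev, ew, ew, ← orient_mul_det, Matrix.det_fin_two]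
    ring
  have hedge : ∀ j, K.edgeIntegral j (fun x => K.normal j 0 * v x + K.normal j 1 * w x) =
      2 * ∫ s in (0 : ℝ)..1, sideSign j * ![f, g] (sideIdx j) (refEdgePt j s) := by
    intro j
    rw [edgeIntegral_eq, ← intervalIntegral.integral_const_mul,
      ← intervalIntegral.integral_const_mul]
    congr 1
    funext s
    have hl := (K.len_pos j).ne'
    rw [edgePt_eq_map, normal_apply_zero, normal_apply_one, tangent_apply, tangent_apply]
    generalize K.len j = L at hl ⊢
    fin_cases j <;> simp [sideSign, sideIdx, refVertex, f, g] <;> field_simp <;> ring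
  rw [integral_carrier, ← integral_const_mul]
  simp only [hdiv]
  rw [integral_refSquare_div hf hg, integral_symm_interval (fun x => g !₂[x, -1]),
    integral_symm_interval (fun x => f !₂[1, x]), integral_symm_interval_neg (fun x => g !₂[x, 1]),
    integral_symm_interval_neg (fun x => f !₂[-1, x])]
  simp only [hedge, Fin.sum_univ_four, refEdgePt_zero, refEdgePt_one, refEdgePt_two,
    refEdgePt_three, intervalIntegral.integral_const_mul]
  simp [sideSign, sideIdx]
  ring

end Parallelogram

/-! ### Green's formula for `div div` -/

theorem contDiff_pd {f : Plane → ℝ} (hf : ContDiff ℝ ∞ f) (i : Fin 2) : ContDiff ℝ ∞ (pd i f) := by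
  unfold pd
  exact (hf.fderiv_right (m := ∞) (by simp)).clm_apply contDiff_const

/-- The iterated divergence of a tensor function. -/
def divDiv (M : Plane → Tensor) (x : Plane) : ℝ := ∑ i, pd i (fun y => rowDiv M y i) x

theorem SmoothTensor.rowDiv {M : Plane → Tensor} (hM : SmoothTensor M) (i : Fin 2) :
    ContDiff ℝ ∞ (fun x => rowDiv M x i) :=
  ContDiff.sum fun j _ => contDiff_pd (hM i j) j

theorem SmoothTensor.divDiv {M : Plane → Tensor} (hM : SmoothTensor M) :
    ContDiff ℝ ∞ (divDiv M) :=
  ContDiff.sum fun i _ => contDiff_pd (hM.rowDiv i) i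

namespace Parallelogram

variable (K : Parallelogram)

theorem integrableOn_carrier {f : Plane → ℝ} (hf : Continuous f) : IntegrableOn f K.carrier := by
  have hc : IsCompact (closure K.carrier) :=
    Metric.isCompact_of_isClosed_isBounded isClosed_closure K.isBounded_carrier.closure
  exact (hf.continuousOn.integrableOn_compact hc).mono_set subset_closure

/-- The fundamental theorem of calculus along an edge. The orientation enters because edges are
parametrised from vertex `j` to vertex `j + 1`, which is clockwise if `det B < 0`. -/
theorem edgeIntegral_fderiv_tangent (j : Fin 4) {h : Plane → ℝ} (hh : ContDiff ℝ ∞ h) :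
    K.edgeIntegral j (fun x => fderiv ℝ h x (K.tangent j)) =
      K.orient * (h (K.vertex (j + 1)) - h (K.vertex j)) := by
  have hd : ∀ s ∈ uIcc (0 : ℝ) 1, HasDerivAt (fun s => K.orient * h (K.edgePt j s))
      (K.len j * fderiv ℝ h (K.edgePt j s) (K.tangent j)) s := by
    intro s _
    have h1 : HasDerivAt (fun s => K.edgePt j s) (K.vertex (j + 1) - K.vertex j) s :=
      AffineMap.hasDerivAt_lineMap
    have h2 : HasFDerivAt h (fderiv ℝ h (K.edgePt j s)) (K.edgePt j s) :=
      (hh.differentiable (by simp) _).hasFDerivAt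
    refine ((h2.comp_hasDerivAt s h1).const_mul K.orient).congr_deriv ?_
    have hl := (K.len_pos j).ne'
    rw [tangent, map_smul, smul_eq_mul]
    change _ = K.len j * (K.orient / K.len j * _)
    field_simp
  have hc : Continuous fun s => K.len j * fderiv ℝ h (K.edgePt j s) (K.tangent j) := by
    have h1 : Continuous fun s => K.edgePt j s := AffineMap.lineMap_continuous
    have h2 := (hh.continuous_fderiv (by simp)).clm_apply (continuous_const (y := K.tangent j))
    exact continuous_const.mul (h2.comp h1)
  rw [edgeIntegral_eq, ← intervalIntegral.integral_const_mul,
    intervalIntegral.integral_eq_sub_of_hasDerivAt hd (hc.intervalIntegrable _ _), edgePt_zero,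
    edgePt_one]
  ring

/-- Green's formula for `div div` on a parallelogram, with normal-normal traces, effective shear
forces, and jumps at the vertices. -/
theorem green {M : Plane → Tensor} (hM : SmoothTensor M) (hs : ∀ x, (M x).IsSymm)
    {φ : Plane → ℝ} (hφ : ContDiff ℝ ∞ φ) :
    ∫ x in K.carrier, ∑ i, ∑ j, M x i j * pd i (pd j φ) x =
      (∫ x in K.carrier, divDiv M x * φ x) +
        ∑ j, (K.edgeIntegral j (fun x => K.trM j M x * fderiv ℝ φ x (K.normal j)) -
          K.edgeIntegral j (fun x => K.trq j M x * φ x)) +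
        ∑ j, K.jump j M * φ (K.vertex j) := by
  have h10 : ∀ x, M x 1 0 = M x 0 1 := fun x => (hs x).apply 0 1
  -- The vector field `M ∇φ - φ div M`.
  let v : Fin 2 → Plane → ℝ := fun i x =>
    M x i 0 * pd 0 φ x + M x i 1 * pd 1 φ x - φ x * rowDiv M x i
  have hp := fun i => contDiff_pd hφ i
  have hv : ∀ i, ContDiff ℝ ∞ (v i) := fun i =>
    (((hM i 0).mul (hp 0)).add ((hM i 1).mul (hp 1))).sub (hφ.mul (hM.rowDiv i))
  have hdiv : ∀ x, pd 0 (v 0) x + pd 1 (v 1) x =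
      (∑ i, ∑ j, M x i j * pd i (pd j φ) x) - divDiv M x * φ x := by
    intro x
    have d : ∀ {f : Plane → ℝ}, ContDiff ℝ ∞ f → DifferentiableAt ℝ f x := fun h =>
      h.differentiable (by simp) x
    have e : ∀ i k, pd k (v i) x =
        M x i 0 * pd k (pd 0 φ) x + pd 0 φ x * pd k (fun y => M y i 0) x +
          (M x i 1 * pd k (pd 1 φ) x + pd 1 φ x * pd k (fun y => M y i 1) x) -
          (φ x * pd k (fun y => rowDiv M y i) x + rowDiv M x i * pd k φ x) := by
      intro i k
      have d0 := d (hM i 0)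
      have d1 := d (hM i 1)
      have p0 := d (hp 0)
      have p1 := d (hp 1)
      rw [pd_sub ((d0.fun_mul p0).fun_add (d1.fun_mul p1)) ((d hφ).fun_mul (d (hM.rowDiv i))),
        pd_add (d0.fun_mul p0) (d1.fun_mul p1), pd_mul d0 p0, pd_mul d1 p1,
        pd_mul (d hφ) (d (hM.rowDiv i))]
    have e10 : (fun y => M y 1 0) = fun y => M y 0 1 := funext h10
    rw [e, e]
    simp only [divDiv, Fin.sum_univ_two, h10]
    have r0 : rowDiv M x 0 = pd 0 (fun y => M y 0 0) x + pd 1 (fun y => M y 0 1) x := by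
      rw [rowDiv, Fin.sum_univ_two]
    have r1 : rowDiv M x 1 = pd 0 (fun y => M y 0 1) x + pd 1 (fun y => M y 1 1) x := by
      rw [rowDiv, Fin.sum_univ_two, e10]
    rw [r0, r1]
    ring
  have hcH : Continuous fun x => ∑ i, ∑ j, M x i j * pd i (pd j φ) x :=
    continuous_finsetSum _ fun i _ => continuous_finsetSum _ fun j _ =>
      (hM i j).continuous.mul (contDiff_pd (hp j) i).continuous
  have hcD : Continuous fun x => divDiv M x * φ x := hM.divDiv.continuous.mul hφ.continuous
  have key := K.integral_div (hv 0) (hv 1)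
  simp only [hdiv] at key
  rw [integral_sub (K.integrableOn_carrier hcH) (K.integrableOn_carrier hcD),
    sub_eq_iff_eq_add'] at key
  rw [key, add_assoc]
  congr 1
  -- On each edge the gradient of `φ` is split into normal and tangential part.
  have hedge : ∀ j, K.edgeIntegral j (fun x => K.normal j 0 * v 0 x + K.normal j 1 * v 1 x) =
      (K.edgeIntegral j (fun x => K.trM j M x * fderiv ℝ φ x (K.normal j)) -
        K.edgeIntegral j (fun x => K.trq j M x * φ x)) +
      K.orient * (K.tn j M (K.vertex (j + 1)) * φ (K.vertex (j + 1)) -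
        K.tn j M (K.vertex j) * φ (K.vertex j)) := by
    intro j
    have hT := contDiff_tn (K := K) j hM
    have c1 : Continuous fun x => K.trM j M x * fderiv ℝ φ x (K.normal j) :=
      (continuous_trM j hM).mul ((hφ.continuous_fderiv (by simp)).clm_apply continuous_const)
    have c2 : Continuous fun x => K.trq j M x * φ x := (continuous_trq j hM).mul hφ.continuous
    have c3 : Continuous fun x => fderiv ℝ (fun y => K.tn j M y * φ y) x (K.tangent j) :=
      ((hT.mul hφ).continuous_fderiv (by simp)).clm_apply continuous_const
    rw [← K.edgeIntegral_fderiv_tangent j (hT.mul hφ), sub_eq_add_neg,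
      ← neg_one_mul (K.edgeIntegral j _), ← edgeIntegral_smul,
      ← edgeIntegral_add j c1 (c2.const_smul (-1)),
      ← edgeIntegral_add j (c1.add (c2.const_smul (-1))) c3]
    congr 1
    funext x
    have ht := K.tangent_sq j
    have hmul : fderiv ℝ (fun y => K.tn j M y * φ y) x (K.tangent j) =
        K.tn j M x * fderiv ℝ φ x (K.tangent j) + φ x * fderiv ℝ (K.tn j M) x (K.tangent j) := by
      rw [fderiv_fun_mul (hT.differentiable (by simp) x) (hφ.differentiable (by simp) x)]
      rfl
    have hq : K.trq j M x = K.normal j 0 * rowDiv M x 0 + K.normal j 1 * rowDiv M x 1 +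
        fderiv ℝ (K.tn j M) x (K.tangent j) := by
      rw [trq, dotProduct, Fin.sum_univ_two]
    simp only [Pi.add_apply, Pi.smul_apply, smul_eq_mul]
    rw [hmul, hq, fderiv_apply_eq_pd φ, fderiv_apply_eq_pd φ]
    simp only [trM, tn, dotProduct, Matrix.mulVec, Fin.sum_univ_two, normal_apply_zero,
      normal_apply_one, h10, v]
    linear_combination (-(M x 0 0 * K.tangent j 1 - M x 0 1 * K.tangent j 0) * pd 0 φ x -
      (M x 0 1 * K.tangent j 1 - M x 1 1 * K.tangent j 0) * pd 1 φ x) * ht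
  simp only [hedge, Finset.sum_add_distrib]
  congr 1
  simp only [jump_eq, Fin.sum_univ_four]
  simp only [show (0 : Fin 4) - 1 = 3 from rfl, show (1 : Fin 4) - 1 = 0 from rfl,
    show (2 : Fin 4) - 1 = 1 from rfl, show (3 : Fin 4) - 1 = 2 from rfl,
    show (0 : Fin 4) + 1 = 1 from rfl, show (1 : Fin 4) + 1 = 2 from rfl,
    show (2 : Fin 4) + 1 = 3 from rfl, show (3 : Fin 4) + 1 = 0 from rfl]
  ring

end Parallelogram

/-! ### Inclusion in `H(div div, Ω)` -/

namespace Parallelogram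

variable (K : Parallelogram)

theorem edgeIntegral_congr (j : Fin 4) {f g : Plane → ℝ} (h : ∀ x ∈ K.edge j, f x = g x) :
    K.edgeIntegral j f = K.edgeIntegral j g := by
  rw [edgeIntegral_eq, edgeIntegral_eq, intervalIntegral.integral_of_le zero_le_one,
    intervalIntegral.integral_of_le zero_le_one, integral_Ioc_eq_integral_Ioo,
    integral_Ioc_eq_integral_Ioo]
  congr 1
  exact setIntegral_congr_fun measurableSet_Ioo fun s hs => h _ (K.edgePt_mem_edge j hs)

theorem exists_nonconstant (j : Fin 4) :
    ∃ l : Plane →ᵃ[ℝ] ℝ, ∃ x ∈ K.edge j, ∃ y ∈ K.edge j, l x ≠ l y := by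
  obtain ⟨i, hi⟩ : ∃ i, K.vertex j i ≠ K.vertex (j + 1) i := by
    by_contra h
    simp only [not_exists, not_not] at h
    exact K.vertex_ne_next j (Plane.ext (h 0) (h 1))
  refine ⟨((EuclideanSpace.proj i : Plane →L[ℝ] ℝ) : Plane →ₗ[ℝ] ℝ).toAffineMap,
    _, K.edgePt_mem_edge j (s := 1 / 3) (by norm_num), _,
    K.edgePt_mem_edge j (s := 2 / 3) (by norm_num), fun h => hi ?_⟩
  have e : ∀ s, K.edgePt j s i = K.vertex j i + s * (K.vertex (j + 1) i - K.vertex j i) := by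
    intro s
    simp [edgePt, AffineMap.lineMap_apply]
    ring
  have h : K.edgePt j (1 / 3) i = K.edgePt j (2 / 3) i := h
  rw [e, e] at h
  linarith

theorem isSymm_of_mem_localSpace {M : Plane → Tensor} (hM : M ∈ K.localSpace) (x : Plane) :
    (M x).IsSymm := by
  obtain ⟨N, hN, rfl⟩ := hM
  refine Matrix.IsSymm.smul ?_ _
  rw [Matrix.IsSymm, Matrix.transpose_mul, Matrix.transpose_mul, Matrix.transpose_transpose,
    (hN.1 _).eq, Matrix.mul_assoc]

theorem memLp_indicator_carrier {f : Plane → ℝ} (hf : Continuous f) (μ : Measure Plane)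
    [IsFiniteMeasureOnCompacts μ] : MemLp (K.carrier.indicator f) 2 μ := by
  rw [memLp_indicator_iff_restrict K.isOpen_carrier.measurableSet]
  have hc : IsCompact (closure K.carrier) :=
    Metric.isCompact_of_isClosed_isBounded isClosed_closure K.isBounded_carrier.closure
  have : IsFiniteMeasure (μ.restrict K.carrier) :=
    ⟨by
      rw [Measure.restrict_apply_univ]
      exact (measure_mono subset_closure).trans_lt hc.measure_lt_top⟩
  obtain ⟨C, hC⟩ := hc.exists_bound_of_continuousOn hf.continuousOn
  refine MemLp.of_bound hf.aestronglyMeasurable C ?_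
  filter_upwards [ae_restrict_mem K.isOpen_carrier.measurableSet] with x hx
  exact hC x (subset_closure hx)

end Parallelogram

namespace ParallelogramMesh

variable {Ω : Set Plane} {ι : Type*} [Fintype ι] (T : ParallelogramMesh Ω ι)

variable {T} in
/-- The moment conditions give pointwise equality, since the traces have degree one on the edge. -/
theorem trM_eq_of_mem {M : ι → Plane → Tensor} (hM : M ∈ T.dDivSpace) {i i' : ι} {j j' : Fin 4}
    (hi : i ≠ i') (he : (T.elem i).edge j = (T.elem i').edge j') {x : Plane}
    (hx : x ∈ (T.elem i).edge j) :
    (T.elem i).trM j (M i) x = (T.elem i').trM j' (M i') x := by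
  obtain ⟨l, hl⟩ := (T.elem i).exists_nonconstant j
  have h0 := (hM.2.1 i i' j j' hi he (AffineMap.const ℝ Plane 1)).1
  have h1 := (hM.2.1 i i' j j' hi he l).1
  simp only [AffineMap.const_apply, mul_one] at h0
  have ha := ((T.elem i).affineOnEdge_trM j (hM.1 i)).sub
    (((T.elem i').affineOnEdge_trM j' (hM.1 i')).of_edge_eq he.symm)
  rw [Parallelogram.edge_eq_image] at hx
  obtain ⟨s, -, rfl⟩ := hx
  exact sub_eq_zero.mp (ha.eq_zero_of_moments hl h0 h1 s)

variable {T} in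
/-- The analogue of `trM_eq_of_mem` for the effective shear forces. -/
theorem trq_eq_of_mem {M : ι → Plane → Tensor} (hM : M ∈ T.dDivSpace) {i i' : ι} {j j' : Fin 4}
    (hi : i ≠ i') (he : (T.elem i).edge j = (T.elem i').edge j') {x : Plane}
    (hx : x ∈ (T.elem i).edge j) :
    (T.elem i').trq j' (M i') x = - (T.elem i).trq j (M i) x := by
  obtain ⟨l, hl⟩ := (T.elem i).exists_nonconstant j
  have h0 := (hM.2.1 i i' j j' hi he (AffineMap.const ℝ Plane 1)).2
  have h1 := (hM.2.1 i i' j j' hi he l).2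
  simp only [AffineMap.const_apply, mul_one] at h0
  have ha := ((T.elem i).affineOnEdge_trq j (hM.1 i)).add
    (((T.elem i').affineOnEdge_trq j' (hM.1 i')).of_edge_eq he.symm)
  rw [Parallelogram.edge_eq_image] at hx
  obtain ⟨s, -, rfl⟩ := hx
  exact eq_neg_of_add_eq_zero_right (ha.eq_zero_of_moments hl h0 h1 s)

/-- The contribution of one edge of one element to Green's formula. -/
def edgeTerm (M : ι → Plane → Tensor) (φ : Plane → ℝ) (p : ι × Fin 4) : ℝ :=
  (T.elem p.1).edgeIntegral p.2
      (fun x => (T.elem p.1).trM p.2 (M p.1) x * fderiv ℝ φ x ((T.elem p.1).normal p.2)) -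
    (T.elem p.1).edgeIntegral p.2 (fun x => (T.elem p.1).trq p.2 (M p.1) x * φ x)

theorem edgeTerm_add {M : ι → Plane → Tensor} (hM : M ∈ T.dDivSpace) (φ : Plane → ℝ)
    {p q : ι × Fin 4} (hpq : p.1 ≠ q.1) (he : (T.elem p.1).edge p.2 = (T.elem q.1).edge q.2) :
    T.edgeTerm M φ p + T.edgeTerm M φ q = 0 := by
  have h1 : (T.elem q.1).edgeIntegral q.2
      (fun x => (T.elem q.1).trM q.2 (M q.1) x * fderiv ℝ φ x ((T.elem q.1).normal q.2)) =
      -1 * (T.elem p.1).edgeIntegral p.2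
      (fun x => (T.elem p.1).trM p.2 (M p.1) x * fderiv ℝ φ x ((T.elem p.1).normal p.2)) := by
    rw [Parallelogram.edgeIntegral_of_edge_eq he, ← Parallelogram.edgeIntegral_smul]
    refine Parallelogram.edgeIntegral_congr _ _ fun x hx => ?_
    rw [T.normal_eq_neg hpq he, ← trM_eq_of_mem hM hpq he hx, map_neg]
    simp
  have h2 : (T.elem q.1).edgeIntegral q.2 (fun x => (T.elem q.1).trq q.2 (M q.1) x * φ x) =
      -1 * (T.elem p.1).edgeIntegral p.2 (fun x => (T.elem p.1).trq p.2 (M p.1) x * φ x) := by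
    rw [Parallelogram.edgeIntegral_of_edge_eq he, ← Parallelogram.edgeIntegral_smul]
    refine Parallelogram.edgeIntegral_congr _ _ fun x hx => ?_
    rw [trq_eq_of_mem hM hpq he hx]
    simp
  rw [edgeTerm, edgeTerm, h1, h2]
  ring

theorem edgeTerm_eq_zero (M : ι → Plane → Tensor) {φ : Plane → ℝ} (hφ : tsupport φ ⊆ Ω)
    {p : ι × Fin 4}
    (hp : ¬ ∃ q : ι × Fin 4, p.1 ≠ q.1 ∧ (T.elem p.1).edge p.2 = (T.elem q.1).edge q.2) :
    T.edgeTerm M φ p = 0 := by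
  have hx : ∀ x ∈ (T.elem p.1).edge p.2, x ∉ tsupport φ := by
    intro x hx hs
    obtain ⟨i', j', h⟩ := T.exists_common_edge hx (hφ hs)
    exact hp ⟨(i', j'), h⟩
  have h1 : (T.elem p.1).edgeIntegral p.2
      (fun x => (T.elem p.1).trM p.2 (M p.1) x * fderiv ℝ φ x ((T.elem p.1).normal p.2)) =
      (T.elem p.1).edgeIntegral p.2 (fun _ => 0) := by
    refine Parallelogram.edgeIntegral_congr _ _ fun x h => ?_
    have : fderiv ℝ φ x = 0 :=
      image_eq_zero_of_notMem_tsupport fun h' => hx x h (tsupport_fderiv_subset ℝ h')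
    rw [this]
    simp
  have h2 : (T.elem p.1).edgeIntegral p.2 (fun x => (T.elem p.1).trq p.2 (M p.1) x * φ x) =
      (T.elem p.1).edgeIntegral p.2 (fun _ => 0) := by
    refine Parallelogram.edgeIntegral_congr _ _ fun x h => ?_
    rw [image_eq_zero_of_notMem_tsupport (hx x h), mul_zero]
  rw [edgeTerm, h1, h2, sub_self]

open Classical in
theorem sum_edgeTerm {M : ι → Plane → Tensor} (hM : M ∈ T.dDivSpace) {φ : Plane → ℝ}
    (hφ : tsupport φ ⊆ Ω) : ∑ p, T.edgeTerm M φ p = 0 := by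
  -- The involution exchanges the two sides of a common edge.
  let P : ι × Fin 4 → Prop := fun p =>
    ∃ q : ι × Fin 4, p.1 ≠ q.1 ∧ (T.elem p.1).edge p.2 = (T.elem q.1).edge q.2
  let g : ι × Fin 4 → ι × Fin 4 := fun p => if h : P p then h.choose else p
  have hg : ∀ p, P p → p.1 ≠ (g p).1 ∧
      (T.elem p.1).edge p.2 = (T.elem (g p).1).edge (g p).2 := by
    intro p h
    simp only [g, dif_pos h]
    exact h.choose_spec
  refine Finset.sum_involution (fun p _ => g p) (fun p _ => ?_) (fun p _ hp => ?_)
    (fun p _ => Finset.mem_univ _) (fun p _ => ?_)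
  · by_cases h : P p
    · exact T.edgeTerm_add hM φ (hg p h).1 (hg p h).2
    · have h0 := T.edgeTerm_eq_zero M hφ h
      simp only [g, dif_neg h, h0, add_zero]
  · have h : P p := by
      by_contra h
      exact hp (T.edgeTerm_eq_zero M hφ h)
    intro he
    exact (hg p h).1 (congrArg Prod.fst he).symm
  · by_cases h : P p
    · obtain ⟨h1, h2⟩ := hg p h
      obtain ⟨h3, h4⟩ := hg (g p) ⟨p, h1.symm, h2.symm⟩
      have e1 : (g (g p)).1 = p.1 := T.eq_of_common_edge h3 h1.symm h4 h2.symm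
      refine Prod.ext e1 ((T.elem p.1).edge_injective ?_)
      rw [h2, h4, e1]
    · have e : g p = p := dif_neg h
      simp only [e]

open Classical in
theorem sum_jump {g : ι → Fin 4 → ℝ} (hg : ∀ n ∈ T.interiorVertices, T.vertexSum g n = 0)
    {φ : Plane → ℝ} (hφ : tsupport φ ⊆ Ω) :
    ∑ i, ∑ j, g i j * φ ((T.elem i).vertex j) = 0 := by
  let V : Finset Plane := Finset.univ.image fun p : ι × Fin 4 => (T.elem p.1).vertex p.2
  have hV : ∀ i j, (T.elem i).vertex j ∈ V := fun i j =>
    Finset.mem_image.mpr ⟨(i, j), Finset.mem_univ _, rfl⟩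
  have h1 : ∀ i j, g i j * φ ((T.elem i).vertex j) =
      ∑ n ∈ V, (if (T.elem i).vertex j = n then g i j else 0) * φ n := by
    intro i j
    rw [Finset.sum_eq_single_of_mem _ (hV i j)]
    · rw [if_pos rfl]
    · intro n _ hn
      rw [if_neg (Ne.symm hn), zero_mul]
  have h2 : ∀ n ∈ V, ∑ i, ∑ j, (if (T.elem i).vertex j = n then g i j else 0) * φ n = 0 := by
    intro n hn
    by_cases hΩ : n ∈ Ω
    · obtain ⟨⟨i, j⟩, -, hij⟩ := Finset.mem_image.mp hn
      have := hg n ⟨hΩ, i, j, hij.symm⟩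
      simp only [← Finset.sum_mul]
      rw [vertexSum] at this
      rw [this, zero_mul]
    · have : φ n = 0 := image_eq_zero_of_notMem_tsupport fun h => hΩ (hφ h)
      simp [this]
  simp only [h1]
  refine Eq.trans ?_ (Finset.sum_eq_zero h2)
  rw [Finset.sum_comm (s := V)]
  exact Finset.sum_congr rfl fun i _ => Finset.sum_comm

theorem assemble_apply (M : ι → Plane → Tensor) (x : Plane) (i j : Fin 2) :
    T.assemble M x i j = ∑ k, (T.elem k).carrier.indicator (fun y => M k y i j) x := by
  rw [assemble, Matrix.sum_apply]
  refine Finset.sum_congr rfl fun k _ => ?_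
  by_cases h : x ∈ (T.elem k).carrier <;> simp [h]

theorem setIntegral_sum_indicator {G : ι → Plane → ℝ} (hG : ∀ k, Continuous (G k)) :
    ∫ x in Ω, ∑ k, (T.elem k).carrier.indicator (G k) x = ∑ k, ∫ x in (T.elem k).carrier, G k x := by
  have hm := fun k => (T.elem k).isOpen_carrier.measurableSet
  rw [integral_finsetSum _ fun k _ => ?_]
  · refine Finset.sum_congr rfl fun k _ => ?_
    rw [setIntegral_indicator (hm k), inter_eq_self_of_subset_right (T.subset k)]
  · exact ((integrable_indicator_iff (hm k)).mpr
      ((T.elem k).integrableOn_carrier (hG k))).integrableOn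

/-- The distributional `div div` is the elementwise one, because the edge and vertex terms of Green's
formula add up to zero. -/
theorem memHdDiv_assemble {M : ι → Plane → Tensor} (hM : M ∈ T.dDivSpace) :
    MemHdDiv Ω (T.assemble M) := by
  have hsm := fun k => (T.elem k).smooth_localSpace (hM.1 k)
  have hsy := fun k => (T.elem k).isSymm_of_mem_localSpace (hM.1 k)
  refine ⟨fun i j => ?_, .of_forall fun x => ?_,
    fun x => ∑ k, (T.elem k).carrier.indicator (divDiv (M k)) x, ?_, fun φ hφ _ hsupp => ?_⟩
  · simp only [assemble_apply]
    exact memLp_finsetSum _ fun k _ =>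
      (T.elem k).memLp_indicator_carrier (hsm k i j).continuous _
  · ext i j
    rw [Matrix.transpose_apply, assemble_apply, assemble_apply]
    refine Finset.sum_congr rfl fun k _ => ?_
    congr 1
    funext y
    exact (hsy k y).apply i j
  · exact memLp_finsetSum _ fun k _ =>
      (T.elem k).memLp_indicator_carrier (hsm k).divDiv.continuous _
  · have hL : ∀ x, ∑ i, ∑ j, T.assemble M x i j * pd i (pd j φ) x =
        ∑ k, (T.elem k).carrier.indicator
          (fun y => ∑ i, ∑ j, M k y i j * pd i (pd j φ) y) x := by
      intro x
      simp only [assemble_apply, Finset.sum_mul]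
      have : ∀ k, (T.elem k).carrier.indicator
          (fun y => ∑ i, ∑ j, M k y i j * pd i (pd j φ) y) x =
          ∑ i, ∑ j, (T.elem k).carrier.indicator (fun y => M k y i j) x * pd i (pd j φ) x := by
        intro k
        by_cases h : x ∈ (T.elem k).carrier <;> simp [h]
      rw [Finset.sum_congr rfl fun k _ => this k]
      simp only [Fin.sum_univ_two, Finset.sum_add_distrib]
    have hR : ∀ x, (∑ k, (T.elem k).carrier.indicator (divDiv (M k)) x) * φ x =
        ∑ k, (T.elem k).carrier.indicator (fun y => divDiv (M k) y * φ y) x := by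
      intro x
      rw [Finset.sum_mul]
      refine Finset.sum_congr rfl fun k _ => ?_
      by_cases h : x ∈ (T.elem k).carrier <;> simp [h]
    have hc : ∀ k, Continuous fun y => ∑ i, ∑ j, M k y i j * pd i (pd j φ) y := fun k =>
      continuous_finsetSum _ fun i _ => continuous_finsetSum _ fun j _ =>
        (hsm k i j).continuous.mul (contDiff_pd (contDiff_pd hφ j) i).continuous
    simp only [hL, hR]
    have hc' : ∀ k, Continuous fun y => divDiv (M k) y * φ y := fun k =>
      (hsm k).divDiv.continuous.mul hφ.continuous
    rw [T.setIntegral_sum_indicator hc, T.setIntegral_sum_indicator hc']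
    have hE := T.sum_edgeTerm hM hsupp
    rw [Fintype.sum_prod_type] at hE
    have hJ := T.sum_jump hM.2.2 hsupp
    have hG := fun k => (T.elem k).green (hsm k) (hsy k) hφ
    simp only [hG, Finset.sum_add_distrib]
    simp only [edgeTerm] at hE
    rw [hE, hJ, add_zero, add_zero]

end ParallelogramMesh

theorem Parallelogram.dofs_apply (K : Parallelogram) (l : Fin 4 → (Plane →ᵃ[ℝ] ℝ))
    (M : K.localSpace) (j : Fin 4) :
    K.dofs l M j = (K.edgeIntegral j (fun x => K.trM j M x),
      K.edgeIntegral j (fun x => K.trM j M x * l j x), K.edgeIntegral j (fun x => K.trq j M x),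
      K.edgeIntegral j (fun x => K.trq j M x * l j x), K.jump j M) := by
  simp [dofs, momM, momQ, jumpL]

namespace ParallelogramMesh

variable {Ω : Set Plane} {ι : Type*} [Fintype ι] (T : ParallelogramMesh Ω ι)

/-! ### Global degrees of freedom -/

/-- The `j`-th edge of the `i`-th element as an edge of the mesh. -/
def meshEdge (i : ι) (j : Fin 4) : T.edges := ⟨(T.elem i).edge j, i, j, rfl⟩

variable {T}

theorem edgeIntegral_trM_of_mem {M : ι → Plane → Tensor} (hM : M ∈ T.dDivSpace) {i i' : ι}
    {j j' : Fin 4} (he : (T.elem i).edge j = (T.elem i').edge j') (l : Plane → ℝ) :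
    (T.elem i').edgeIntegral j' (fun x => (T.elem i').trM j' (M i') x * l x) =
      (T.elem i).edgeIntegral j (fun x => (T.elem i).trM j (M i) x * l x) := by
  by_cases hi : i = i'
  · subst hi
    rw [(T.elem i).edge_injective he]
  · rw [Parallelogram.edgeIntegral_of_edge_eq he]
    refine Parallelogram.edgeIntegral_congr _ _ fun x hx => ?_
    rw [trM_eq_of_mem hM hi he hx]

open Classical in
theorem edgeIntegral_trq_of_mem {M : ι → Plane → Tensor} (hM : M ∈ T.dDivSpace) {i i' : ι}
    {j j' : Fin 4} (he : (T.elem i).edge j = (T.elem i').edge j') (l : Plane → ℝ) :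
    (T.elem i').edgeIntegral j' (fun x => (T.elem i').trq j' (M i') x * l x) =
      (if i = i' then 1 else -1) *
        (T.elem i).edgeIntegral j (fun x => (T.elem i).trq j (M i) x * l x) := by
  by_cases hi : i = i'
  · subst hi
    rw [(T.elem i).edge_injective he, if_pos rfl, one_mul]
  · rw [Parallelogram.edgeIntegral_of_edge_eq he, if_neg hi, ← Parallelogram.edgeIntegral_smul]
    refine Parallelogram.edgeIntegral_congr _ _ fun x hx => ?_
    rw [trq_eq_of_mem hM hi he hx]
    simp

open Classical in
/-- Prescribing the global degrees of freedom amounts to prescribing all local ones: on the side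
opposite to the chosen one the normal-normal moments are the same and the shear force moments
change sign. -/
theorem mem_and_dofs_iff {s : T.edges → ι} {k : T.edges → Fin 4}
    (hsk : ∀ e, (T.elem (s e)).edge (k e) = (e : Set Plane)) {l : T.edges → (Plane →ᵃ[ℝ] ℝ)}
    (hl : ∀ e : T.edges, ∃ x ∈ (e : Set Plane), ∃ y ∈ (e : Set Plane), l e x ≠ l e y)
    {m₀ m₁ q₀ q₁ : T.edges → ℝ} {g : ι → Fin 4 → ℝ}
    (hg : ∀ n ∈ T.interiorVertices, T.vertexSum g n = 0) {M : ι → Plane → Tensor}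
    (hM : ∀ i, M i ∈ (T.elem i).localSpace) :
    (M ∈ T.dDivSpace ∧
      (∀ e, (T.elem (s e)).edgeIntegral (k e)
        (fun x => (T.elem (s e)).trM (k e) (M (s e)) x) = m₀ e) ∧
      (∀ e, (T.elem (s e)).edgeIntegral (k e)
        (fun x => (T.elem (s e)).trM (k e) (M (s e)) x * l e x) = m₁ e) ∧
      (∀ e, (T.elem (s e)).edgeIntegral (k e)
        (fun x => (T.elem (s e)).trq (k e) (M (s e)) x) = q₀ e) ∧
      (∀ e, (T.elem (s e)).edgeIntegral (k e)
        (fun x => (T.elem (s e)).trq (k e) (M (s e)) x * l e x) = q₁ e) ∧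
      (∀ i j, (T.elem i).jump j (M i) = g i j)) ↔
    ∀ i, (T.elem i).dofs (fun j => l (T.meshEdge i j)) ⟨M i, hM i⟩ = fun j =>
      (m₀ (T.meshEdge i j), m₁ (T.meshEdge i j),
        (if s (T.meshEdge i j) = i then 1 else -1) * q₀ (T.meshEdge i j),
        (if s (T.meshEdge i j) = i then 1 else -1) * q₁ (T.meshEdge i j), g i j) := by
  constructor
  · rintro ⟨hD, h1, h2, h3, h4, h5⟩ i
    funext j
    have he := hsk (T.meshEdge i j)
    rw [Parallelogram.dofs_apply, ← h1, ← h2, ← h3, ← h4, ← h5]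
    have e1 := edgeIntegral_trM_of_mem hD he (fun _ => 1)
    have e2 := edgeIntegral_trM_of_mem hD he (l (T.meshEdge i j))
    have e3 := edgeIntegral_trq_of_mem hD he (fun _ => 1)
    have e4 := edgeIntegral_trq_of_mem hD he (l (T.meshEdge i j))
    simp only [mul_one] at e1 e3
    rw [← e1, ← e2, ← e3, ← e4]
  · intro h
    have h' : ∀ i j, _ := fun i j => congrFun (h i) j
    simp only [Parallelogram.dofs_apply, Prod.mk.injEq] at h'
    have hes : ∀ e, T.meshEdge (s e) (k e) = e := fun e => Subtype.ext (hsk e)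
    refine ⟨⟨hM, fun i i' j j' hi he l' => ?_, fun n hn => ?_⟩, fun e => ?_, fun e => ?_,
      fun e => ?_, fun e => ?_, fun i j => (h' i j).2.2.2.2⟩
    · have hE : T.meshEdge i' j' = T.meshEdge i j := Subtype.ext he.symm
      obtain ⟨a1, a2, a3, a4, -⟩ := h' i j
      obtain ⟨b1, b2, b3, b4, -⟩ := h' i' j'
      rw [hE] at b1 b2 b3 b4
      -- exactly one of the two elements is the chosen one
      have hsign : (if s (T.meshEdge i j) = i then (1 : ℝ) else -1) =
          -(if s (T.meshEdge i j) = i' then (1 : ℝ) else -1) := by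
        have hse := hsk (T.meshEdge i j)
        by_cases c : s (T.meshEdge i j) = i
        · rw [if_pos c, if_neg fun c' => hi (c.symm.trans c')]
          norm_num
        · have c' : s (T.meshEdge i j) = i' :=
            (T.eq_of_common_edge hi (Ne.symm c) he hse.symm).symm
          rw [if_neg c, if_pos c']
      rw [hsign] at a3 a4
      rw [Parallelogram.edgeIntegral_of_edge_eq he] at b1 b2 b3 b4
      have hne := hl (T.meshEdge i j)
      have fM := (T.elem i).affineOnEdge_trM j (hM i)
      have fM' := ((T.elem i').affineOnEdge_trM j' (hM i')).of_edge_eq he.symm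
      have fq := (T.elem i).affineOnEdge_trq j (hM i)
      have fq' := ((T.elem i').affineOnEdge_trq j' (hM i')).of_edge_eq he.symm
      have cM := Parallelogram.continuous_trM (K := T.elem i) j ((T.elem i).smooth_localSpace (hM i))
      have cM' := Parallelogram.continuous_trM (K := T.elem i') j'
        ((T.elem i').smooth_localSpace (hM i'))
      have cq := Parallelogram.continuous_trq (K := T.elem i) j ((T.elem i).smooth_localSpace (hM i))
      have cq' := Parallelogram.continuous_trq (K := T.elem i') j'
        ((T.elem i').smooth_localSpace (hM i'))
      have cl : Continuous (l (T.meshEdge i j)) := (l (T.meshEdge i j)).continuous_of_finiteDimensional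
      have hadd : ∀ {f f' : Plane → ℝ}, Continuous f → Continuous f' →
          ∀ c : ℝ, (T.elem i).edgeIntegral j (fun x => f x + c * f' x) =
            (T.elem i).edgeIntegral j f + c * (T.elem i).edgeIntegral j f' := by
        intro f f' hf hf' c
        rw [← Parallelogram.edgeIntegral_smul]
        exact Parallelogram.edgeIntegral_add j hf (hf'.const_smul c)
      have zM : ∀ x ∈ (T.elem i).edge j,
          (T.elem i).trM j (M i) x - (T.elem i').trM j' (M i') x = 0 := by
        intro x hx
        rw [Parallelogram.edge_eq_image] at hx
        obtain ⟨p, -, rfl⟩ := hx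
        refine (fM.sub fM').eq_zero_of_moments hne ?_ ?_ p
        · have := hadd cM cM' (-1)
          rw [a1, b1] at this
          refine Eq.trans ?_ (this.trans (by ring))
          congr 1
          funext x
          ring
        · have := hadd (cM.mul cl) (cM'.mul cl) (-1)
          refine Eq.trans ?_ (this.trans ((congrArg₂ (fun u v => u + -1 * v) a2 b2).trans (by ring)))
          congr 1
          funext x
          simp only [Pi.mul_apply]
          ring
      have zq : ∀ x ∈ (T.elem i).edge j,
          (T.elem i).trq j (M i) x + (T.elem i').trq j' (M i') x = 0 := by
        intro x hx
        rw [Parallelogram.edge_eq_image] at hx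
        obtain ⟨p, -, rfl⟩ := hx
        refine (fq.add fq').eq_zero_of_moments hne ?_ ?_ p
        · have := hadd cq cq' 1
          rw [a3, b3] at this
          refine Eq.trans ?_ (this.trans (by ring))
          congr 1
          funext x
          ring
        · have := hadd (cq.mul cl) (cq'.mul cl) 1
          refine Eq.trans ?_ (this.trans ((congrArg₂ (fun u v => u + 1 * v) a4 b4).trans (by ring)))
          congr 1
          funext x
          simp only [Pi.mul_apply]
          ring
      have h0 : (T.elem i).edgeIntegral j (fun _ => 0) = 0 := by
        simp [Parallelogram.edgeIntegral]
      constructor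
      · rw [← h0]
        refine Parallelogram.edgeIntegral_congr _ _ fun x hx => ?_
        rw [zM x hx, zero_mul]
      · rw [← h0]
        refine Parallelogram.edgeIntegral_congr _ _ fun x hx => ?_
        rw [zq x hx, zero_mul]
    · rw [← hg n hn]
      congr 1
      funext i j
      exact (h' i j).2.2.2.2
    · have := (h' (s e) (k e)).1
      rwa [hes] at this
    · have := (h' (s e) (k e)).2.1
      rwa [hes] at this
    · have := (h' (s e) (k e)).2.2.1
      rwa [hes, if_pos rfl, one_mul] at this
    · have := (h' (s e) (k e)).2.2.2.1
      rwa [hes, if_pos rfl, one_mul] at this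

/-- By `mem_and_dofs_iff` the global problem decouples into the local ones, which
`Parallelogram.dofs_bijective` solves. -/
theorem existsUnique_dofs {s : T.edges → ι} {k : T.edges → Fin 4}
    (hsk : ∀ e, (T.elem (s e)).edge (k e) = (e : Set Plane)) {l : T.edges → (Plane →ᵃ[ℝ] ℝ)}
    (hl : ∀ e : T.edges, ∃ x ∈ (e : Set Plane), ∃ y ∈ (e : Set Plane), l e x ≠ l e y)
    (m₀ m₁ q₀ q₁ : T.edges → ℝ) {g : ι → Fin 4 → ℝ}
    (hg : ∀ n ∈ T.interiorVertices, T.vertexSum g n = 0) :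
    ∃! M : ι → Plane → Tensor, M ∈ T.dDivSpace ∧
      (∀ e, (T.elem (s e)).edgeIntegral (k e)
        (fun x => (T.elem (s e)).trM (k e) (M (s e)) x) = m₀ e) ∧
      (∀ e, (T.elem (s e)).edgeIntegral (k e)
        (fun x => (T.elem (s e)).trM (k e) (M (s e)) x * l e x) = m₁ e) ∧
      (∀ e, (T.elem (s e)).edgeIntegral (k e)
        (fun x => (T.elem (s e)).trq (k e) (M (s e)) x) = q₀ e) ∧
      (∀ e, (T.elem (s e)).edgeIntegral (k e)
        (fun x => (T.elem (s e)).trq (k e) (M (s e)) x * l e x) = q₁ e) ∧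
      (∀ i j, (T.elem i).jump j (M i) = g i j) := by
  classical
  have hb : ∀ i, Function.Bijective ((T.elem i).dofs fun j => l (T.meshEdge i j)) := fun i =>
    (T.elem i).dofs_bijective fun j => hl (T.meshEdge i j)
  choose M hM using fun i => (hb i).2 fun j =>
    (m₀ (T.meshEdge i j), m₁ (T.meshEdge i j),
      (if s (T.meshEdge i j) = i then 1 else -1) * q₀ (T.meshEdge i j),
      (if s (T.meshEdge i j) = i then 1 else -1) * q₁ (T.meshEdge i j), g i j)
  refine ⟨fun i => M i, (mem_and_dofs_iff hsk hl hg fun i => (M i).2).mpr hM, fun N hN => ?_⟩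
  have hN' := (mem_and_dofs_iff hsk hl hg hN.1.1).mp hN
  funext i
  exact congrArg Subtype.val ((hb i).1 ((hN' i).trans (hM i).symm))

/-! ### The dimension -/

variable (T)

theorem finite_edges : T.edges.Finite := by
  have : T.edges = range fun p : ι × Fin 4 => (T.elem p.1).edge p.2 := by
    ext e
    simp [edges, eq_comm]
  rw [this]
  exact finite_range _

theorem finite_interiorVertices : T.interiorVertices.Finite := by
  refine (finite_range fun p : ι × Fin 4 => (T.elem p.1).vertex p.2).subset ?_
  rintro n ⟨-, i, j, rfl⟩
  exact ⟨(i, j), rfl⟩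

/-- The sums of vertex values at the interior vertices, as a linear map. -/
def vertexSumL : (ι → Fin 4 → ℝ) →ₗ[ℝ] T.interiorVertices → ℝ where
  toFun g n := T.vertexSum g n
  map_add' g h := by
    funext n
    simp only [vertexSum, Pi.add_apply, ← Finset.sum_add_distrib]
    refine Finset.sum_congr rfl fun i _ => Finset.sum_congr rfl fun j _ => ?_
    split_ifs <;> simp
  map_smul' c g := by
    funext n
    simp only [vertexSum, Pi.smul_apply, smul_eq_mul, RingHom.id_apply, Finset.mul_sum]
    refine Finset.sum_congr rfl fun i _ => Finset.sum_congr rfl fun j _ => ?_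
    split_ifs <;> simp

/-- The sums at different vertices involve different values, so that a single nonzero value at one of
the adjacent elements produces any given sum. -/
theorem vertexSumL_surjective : Function.Surjective T.vertexSumL := by
  classical
  have := T.finite_interiorVertices.fintype
  choose a b hab using fun n : T.interiorVertices => n.2.2
  have h : ∀ n, T.vertexSumL (Pi.single (a n) (Pi.single (b n) 1)) = Pi.single n 1 := by
    intro n
    funext m
    change T.vertexSum _ _ = _
    rw [vertexSum, Finset.sum_eq_single (a n), Finset.sum_eq_single (b n), ← hab]
    · simp only [Pi.single_eq_same, Pi.single_apply, Subtype.ext_iff]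
      exact if_congr eq_comm rfl rfl
    · intro j _ hj
      simp [hj]
    · simp
    · intro i _ hi
      simp [hi]
    · simp
  intro f
  refine ⟨∑ n, f n • Pi.single (a n) (Pi.single (b n) 1), ?_⟩
  rw [map_sum]
  simp only [map_smul, h]
  funext m
  simp [Pi.single_apply]

theorem finrank_ker_vertexSumL :
    (Module.finrank ℝ (LinearMap.ker T.vertexSumL) : ℤ) =
      4 * Fintype.card ι - T.interiorVertices.ncard := by
  have := T.finite_interiorVertices.fintype
  have h := T.vertexSumL.finrank_range_add_finrank_ker
  rw [LinearMap.range_eq_top.mpr T.vertexSumL_surjective, finrank_top, Module.finrank_pi,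
    Module.finrank_pi_fintype] at h
  simp only [Module.finrank_pi, Finset.sum_const, Finset.card_univ, Fintype.card_fin,
    smul_eq_mul] at h
  rw [← Nat.card_coe_set_eq, Nat.card_eq_fintype_card]
  omega

/-- The restriction of an element of the conforming space to one element of the mesh. -/
def restrictL (i : ι) : T.dDivSpace →ₗ[ℝ] (T.elem i).localSpace :=
  (LinearMap.proj i ∘ₗ T.dDivSpace.subtype).codRestrict _ fun M => M.2.1 i

theorem finite_and_finrank_dDivSpace : Module.Finite ℝ T.dDivSpace ∧
    (Module.finrank ℝ T.dDivSpace : ℤ) =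
      4 * (T.edges.ncard : ℤ) + 4 * (Fintype.card ι : ℤ) - (T.interiorVertices.ncard : ℤ) := by
  classical
  have := T.finite_edges.fintype
  choose s k hsk' using fun e : T.edges => e.2
  have hsk : ∀ e, (T.elem (s e)).edge (k e) = (e : Set Plane) := fun e => (hsk' e).symm
  have hl' : ∀ e : T.edges, ∃ l : Plane →ᵃ[ℝ] ℝ,
      ∃ x ∈ (e : Set Plane), ∃ y ∈ (e : Set Plane), l x ≠ l y := by
    intro e
    rw [← hsk e]
    exact (T.elem (s e)).exists_nonconstant (k e)
  choose l hl using hl'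
  let one : Plane →ᵃ[ℝ] ℝ := AffineMap.const ℝ Plane 1
  let A : T.dDivSpace →ₗ[ℝ] T.edges → ℝ × ℝ × ℝ × ℝ :=
    LinearMap.pi fun e => (((T.elem (s e)).momM (k e) one).prod <|
      ((T.elem (s e)).momM (k e) (l e)).prod <| ((T.elem (s e)).momQ (k e) one).prod
        ((T.elem (s e)).momQ (k e) (l e))) ∘ₗ T.restrictL (s e)
  let J : T.dDivSpace →ₗ[ℝ] ι → Fin 4 → ℝ :=
    LinearMap.pi fun i => LinearMap.pi fun j => (T.elem i).jumpL j ∘ₗ T.restrictL i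
  let Φ : T.dDivSpace →ₗ[ℝ] (T.edges → ℝ × ℝ × ℝ × ℝ) × LinearMap.ker T.vertexSumL :=
    A.prod (J.codRestrict _ fun M => funext fun n => M.2.2.2 n n.2)
  have hA : ∀ (M : T.dDivSpace) e, A M e =
      ((T.elem (s e)).edgeIntegral (k e) (fun x => (T.elem (s e)).trM (k e) (M.1 (s e)) x),
        (T.elem (s e)).edgeIntegral (k e) (fun x => (T.elem (s e)).trM (k e) (M.1 (s e)) x * l e x),
        (T.elem (s e)).edgeIntegral (k e) (fun x => (T.elem (s e)).trq (k e) (M.1 (s e)) x),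
        (T.elem (s e)).edgeIntegral (k e)
          (fun x => (T.elem (s e)).trq (k e) (M.1 (s e)) x * l e x)) := by
    intro M e
    simp [A, one, Parallelogram.momM, Parallelogram.momQ]
    exact ⟨rfl, rfl, rfl, rfl⟩
  have hΦ : Function.Bijective Φ := by
    constructor
    · intro M N hMN
      have h1 := fun e => (hA M e).symm.trans
        ((congrFun (congrArg Prod.fst hMN) e).trans (hA N e))
      have h2 : ∀ i j, (T.elem i).jump j (M.1 i) = (T.elem i).jump j (N.1 i) := fun i j =>
        congrFun (congrFun (congrArg (fun t => (t.2 : ι → Fin 4 → ℝ)) hMN) i) j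
      simp only [Prod.mk.injEq] at h1
      exact Subtype.ext ((existsUnique_dofs hsk hl _ _ _ _ N.2.2.2).unique
        ⟨M.2, fun e => (h1 e).1, fun e => (h1 e).2.1, fun e => (h1 e).2.2.1,
          fun e => (h1 e).2.2.2, h2⟩
        ⟨N.2, fun _ => rfl, fun _ => rfl, fun _ => rfl, fun _ => rfl, fun _ _ => rfl⟩)
    · rintro ⟨t, g, hg⟩
      have hg' : ∀ n ∈ T.interiorVertices, T.vertexSum g n = 0 := fun n hn =>
        congrFun (LinearMap.mem_ker.mp hg) ⟨n, hn⟩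
      obtain ⟨M, hM, h1, h2, h3, h4, h5⟩ := (existsUnique_dofs hsk hl (fun e => (t e).1)
        (fun e => (t e).2.1) (fun e => (t e).2.2.1) (fun e => (t e).2.2.2) hg').exists
      refine ⟨⟨M, hM⟩, Prod.ext ?_ (Subtype.ext ?_)⟩
      · funext e
        refine (hA ⟨M, hM⟩ e).trans ?_
        rw [h1, h2, h3, h4]
      · funext i j
        exact h5 i j
  let E := LinearEquiv.ofBijective Φ hΦ
  refine ⟨Module.Finite.equiv E.symm, ?_⟩
  have hk := T.finrank_ker_vertexSumL
  rw [E.finrank_eq, Module.finrank_prod, Module.finrank_pi_fintype, ← Nat.card_coe_set_eq T.edges,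
    Nat.card_eq_fintype_card]
  simp only [Module.finrank_prod, Module.finrank_self, Finset.sum_const, Finset.card_univ,
    smul_eq_mul]
  push_cast
  rw [hk]
  ring

end ParallelogramMesh

end HdDiv

end

theorem proposition4p2 {Ω : Set HdDiv.Plane} {ι : Type*} [Fintype ι]
    (T : HdDiv.ParallelogramMesh Ω ι) :
    (∀ M ∈ T.dDivSpace, HdDiv.MemHdDiv Ω (T.assemble M)) ∧
    (Module.Finite ℝ T.dDivSpace ∧
      (Module.finrank ℝ T.dDivSpace : ℤ) =
        4 * (T.edges.ncard : ℤ) + 4 * (Fintype.card ι : ℤ) - (T.interiorVertices.ncard : ℤ)) ∧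
    -- for every choice of an adjacent element (orientation) for each edge `e` and of a
    -- polynomial `l e` of degree one that is not constant on `e`
    ∀ (s : T.edges → ι) (k : T.edges → Fin 4),
      (∀ e, (T.elem (s e)).edge (k e) = (e : Set HdDiv.Plane)) →
      ∀ l : T.edges → (HdDiv.Plane →ᵃ[ℝ] ℝ),
        (∀ e : T.edges, ∃ x ∈ (e : Set HdDiv.Plane), ∃ y ∈ (e : Set HdDiv.Plane), l e x ≠ l e y) →
        ∀ (m₀ m₁ q₀ q₁ : T.edges → ℝ) (g : ι → Fin 4 → ℝ),
          (∀ n ∈ T.interiorVertices, T.vertexSum g n = 0) →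
          ∃! M : ι → HdDiv.Plane → HdDiv.Tensor, M ∈ T.dDivSpace ∧
            (∀ e, (T.elem (s e)).edgeIntegral (k e)
              (fun x => (T.elem (s e)).trM (k e) (M (s e)) x) = m₀ e) ∧
            (∀ e, (T.elem (s e)).edgeIntegral (k e)
              (fun x => (T.elem (s e)).trM (k e) (M (s e)) x * l e x) = m₁ e) ∧
            (∀ e, (T.elem (s e)).edgeIntegral (k e)
              (fun x => (T.elem (s e)).trq (k e) (M (s e)) x) = q₀ e) ∧
            (∀ e, (T.elem (s e)).edgeIntegral (k e)
              (fun x => (T.elem (s e)).trq (k e) (M (s e)) x * l e x) = q₁ e) ∧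
            (∀ i j, (T.elem i).jump j (M i) = g i j) :=
  ⟨fun _ hM => T.memHdDiv_assemble hM, T.finite_and_finrank_dDivSpace,
    fun _ _ hsk _ hl m₀ m₁ q₀ q₁ _ hg =>
      HdDiv.ParallelogramMesh.existsUnique_dofs hsk hl m₀ m₁ q₀ q₁ hg⟩
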